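/- Let $\mathbf F_q$ be a finite field and let $X \subset \mathbf P^3$ be an elliptic quadric over $\mathbf F_q$, that is, a quadric surface which in suitable homogeneous coordinates over $\mathbf F_q$ has the equation $f(x_0,x_1) + x_2x_3 = 0$, where $f$ is a binary quadratic form irreducible over $\mathbf F_q$. Let $H$ be a plane section of $X$ (the divisor on $X$ cut out by a plane defined over $\mathbf F_q$). Let $s \geq 2$ be an integer and let $D \subset X$ be a curve that is irreducible over $\mathbf F_q$ (a prime divisor of $X$ over $\mathbf F_q$, possibly singular, and possibly reducible over an extension of $\mathbf F_q$) and linearly equivalent to $sH$. Then $$\sharp D(\mathbf F_q) \leq q(2s-2).$$ -/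

import Mathlib

open scoped LinearAlgebra.Projectivization

noncomputable section

namespace QuadricSurface

variable {k : Type*} [Field k]

attribute [local instance] MvPolynomial.gradedAlgebra

/-- The binary quadratic form `a x₀² + b x₀ x₁ + c x₁²`. -/
def binaryForm (a b c : k) : MvPolynomial (Fin 4) k :=
  MvPolynomial.C a * MvPolynomial.X 0 ^ 2
    + MvPolynomial.C b * (MvPolynomial.X 0 * MvPolynomial.X 1)
    + MvPolynomial.C c * MvPolynomial.X 1 ^ 2

/-- `Q` is the equation of an elliptic quadric of `ℙ³`: after an invertible linear change of
coordinates over `k` it becomes `f(x₀, x₁) + x₂ x₃` with `f` a binary quadratic form that is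
irreducible over `k`. -/
def IsEllipticQuadric (Q : MvPolynomial (Fin 4) k) : Prop :=
  ∃ (g : GL (Fin 4) k) (a b c : k), Irreducible (binaryForm a b c) ∧
    MvPolynomial.bind₁ (g : Matrix (Fin 4) (Fin 4) k).toMvPolynomial Q
      = binaryForm a b c + MvPolynomial.X 2 * MvPolynomial.X 3

theorem vars_binaryForm (a b c : k) : (binaryForm a b c).vars ⊆ {0, 1} := by
  classical
  have hm : ∀ m : MvPolynomial (Fin 4) k, ∀ r : k,
      m.vars ⊆ {0, 1} → (MvPolynomial.C r * m).vars ⊆ {0, 1} := by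
    intro m r h
    exact (MvPolynomial.vars_mul _ _).trans (by simpa using h)
  have hX : ∀ j : Fin 4, j ∈ ({0, 1} : Finset (Fin 4)) →
      (MvPolynomial.X j : MvPolynomial (Fin 4) k).vars ⊆ {0, 1} := by
    intro j hj
    rw [MvPolynomial.vars_X]
    exact Finset.singleton_subset_iff.2 hj
  refine (MvPolynomial.vars_add_subset _ _).trans (Finset.union_subset
    ((MvPolynomial.vars_add_subset _ _).trans (Finset.union_subset ?_ ?_)) ?_)
  · exact hm _ _ ((MvPolynomial.vars_pow _ _).trans (hX 0 (by decide)))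
  · exact hm _ _ ((MvPolynomial.vars_mul _ _).trans
      (Finset.union_subset (hX 0 (by decide)) (hX 1 (by decide))))
  · exact hm _ _ ((MvPolynomial.vars_pow _ _).trans (hX 1 (by decide)))

theorem irreducible_normalForm {a b c : k} (hf : Irreducible (binaryForm a b c)) :
    Irreducible (binaryForm a b c + MvPolynomial.X 2 * MvPolynomial.X 3) := by
  rw [add_comm]
  have hX2 : Irreducible (MvPolynomial.X 2 : MvPolynomial (Fin 4) k) :=
    (MvPolynomial.X_prime (R := k) (i := (2 : Fin 4))).irreducible
  refine MvPolynomial.irreducible_mul_X_add _ _ 3 (MvPolynomial.X_ne_zero _) ?_ ?_ ?_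
  · rw [MvPolynomial.vars_X]
    decide
  · intro h
    exact absurd (vars_binaryForm a b c h) (by decide)
  · refine hX2.isRelPrime_iff_not_dvd.2 ?_
    rintro ⟨r, hr⟩
    have h1 := congrArg (MvPolynomial.aeval (R := k)
      (fun i : Fin 4 => if i = 2 then (0 : MvPolynomial (Fin 4) k)
        else MvPolynomial.X i)) hr
    apply hf.ne_zero
    rw [map_mul, MvPolynomial.aeval_X, if_pos rfl, zero_mul] at h1
    rw [← h1]
    simp [binaryForm, MvPolynomial.algebraMap_eq]

theorem bind₁_bind₁_of_mul_eq_one {M N : Matrix (Fin 4) (Fin 4) k} (h : M * N = 1)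
    (p : MvPolynomial (Fin 4) k) :
    MvPolynomial.bind₁ N.toMvPolynomial (MvPolynomial.bind₁ M.toMvPolynomial p) = p := by
  rw [MvPolynomial.bind₁_bind₁]
  have : (fun i => MvPolynomial.bind₁ N.toMvPolynomial (M.toMvPolynomial i))
      = (MvPolynomial.X : Fin 4 → MvPolynomial (Fin 4) k) := by
    funext i
    rw [← Matrix.toMvPolynomial_mul, h, Matrix.toMvPolynomial_one]
  rw [this, MvPolynomial.bind₁_X_left, AlgHom.id_apply]

/-- An elliptic quadric is an integral surface: its equation is a prime polynomial. -/
theorem IsEllipticQuadric.prime {Q : MvPolynomial (Fin 4) k} (hQ : IsEllipticQuadric Q) :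
    Prime Q := by
  obtain ⟨g, a, b, c, hf, hg⟩ := hQ
  let e : MvPolynomial (Fin 4) k ≃ₐ[k] MvPolynomial (Fin 4) k :=
    AlgEquiv.ofAlgHom (MvPolynomial.bind₁ (g : Matrix (Fin 4) (Fin 4) k).toMvPolynomial)
      (MvPolynomial.bind₁ ((g⁻¹ : GL (Fin 4) k) : Matrix (Fin 4) (Fin 4) k).toMvPolynomial)
      (AlgHom.ext fun p => bind₁_bind₁_of_mul_eq_one (Units.inv_mul g) p)
      (AlgHom.ext fun p => bind₁_bind₁_of_mul_eq_one (Units.mul_inv g) p)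
  have he : e Q = binaryForm a b c + MvPolynomial.X 2 * MvPolynomial.X 3 := hg
  rw [← MulEquiv.prime_iff e, he]
  exact (irreducible_normalForm hf).prime

/-- A prime divisor of the surface `Q = 0` in `ℙ³`, that is, a curve on the surface which is
irreducible over `k` (and possibly reducible over an extension of `k`), given by its homogeneous
prime ideal. -/
@[ext]
structure PrimeDivisor (Q : MvPolynomial (Fin 4) k) where
  /-- The ideal of all polynomials that vanish on the curve. -/
  ideal : Ideal (MvPolynomial (Fin 4) k)
  isPrime : ideal.IsPrime
  isHomogeneous : ideal.IsHomogeneous (MvPolynomial.homogeneousSubmodule (Fin 4) k)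
  mem : Q ∈ ideal
  height_eq : ideal.height = 2

instance (Q : MvPolynomial (Fin 4) k) (E : PrimeDivisor Q) : E.ideal.IsPrime := E.isPrime

/-- The rational points of a curve: the `k`-points of `ℙ³` at which all polynomials of its
(homogeneous) ideal vanish. -/
def PrimeDivisor.rationalPoints {Q : MvPolynomial (Fin 4) k} (E : PrimeDivisor Q) :
    Set (ℙ k (Fin 4 → k)) :=
  {P | ∀ F ∈ E.ideal, MvPolynomial.eval P.rep F = 0}

/-- The group of (Weil) divisors of the surface `Q = 0`. -/
abbrev Divisor (Q : MvPolynomial (Fin 4) k) : Type _ := PrimeDivisor Q →₀ ℤ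

/-- The homogeneous coordinate ring `k[x₀, x₁, x₂, x₃] / (Q)` of the surface `Q = 0`. -/
abbrev CoordRing (Q : MvPolynomial (Fin 4) k) : Type _ :=
  MvPolynomial (Fin 4) k ⧸ Ideal.span {Q}

/-- The prime ideal of the curve `E` in the homogeneous coordinate ring of the surface. -/
def PrimeDivisor.coordIdeal {Q : MvPolynomial (Fin 4) k} (E : PrimeDivisor Q) :
    Ideal (CoordRing Q) :=
  E.ideal.map (Ideal.Quotient.mk (Ideal.span {Q}))

instance {Q : MvPolynomial (Fin 4) k} (E : PrimeDivisor Q) : E.coordIdeal.IsPrime := by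
  refine Ideal.map_isPrime_of_surjective Ideal.Quotient.mk_surjective ?_
  rw [Ideal.mk_ker, Ideal.span_singleton_le_iff_mem]
  exact E.mem

/-- The order of vanishing of `x` in a one-dimensional local domain `R` (for `x ≠ 0`): the length
of `R / (x)`, which is the normalized valuation of `x` when `R` is a discrete valuation ring. -/
def ordNat (R : Type*) [CommRing R] (x : R) : ℕ := (Ring.ord R x).toNat

theorem ordNat_of_isUnit {R : Type*} [CommRing R] {x : R} (hx : IsUnit x) : ordNat R x = 0 := by
  rw [ordNat, Ring.ord_of_isUnit hx]
  rfl

/-- The order of vanishing along the curve `E` of the restriction of the form `F` to the surface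
`Q = 0` (for `F` not divisible by `Q`), computed in the localization at `E` of the homogeneous
coordinate ring. The local ring of the surface at `E` is the subring of elements of degree zero of
that localization; a linear form that does not vanish on `E` is a unit there, so both rings give
the same order of vanishing. -/
def PrimeDivisor.ord {Q : MvPolynomial (Fin 4) k} (E : PrimeDivisor Q)
    (F : MvPolynomial (Fin 4) k) : ℕ :=
  ordNat (Localization.AtPrime E.coordIdeal)
    (algebraMap (CoordRing Q) (Localization.AtPrime E.coordIdeal)
      (Ideal.Quotient.mk (Ideal.span {Q}) F))

theorem PrimeDivisor.mem_of_ord_ne_zero {Q : MvPolynomial (Fin 4) k} (E : PrimeDivisor Q)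
    {F : MvPolynomial (Fin 4) k} (h : E.ord F ≠ 0) : F ∈ E.ideal := by
  by_contra hF
  apply h
  have hF' : Ideal.Quotient.mk (Ideal.span {Q}) F ∉ E.coordIdeal := by
    intro hm
    apply hF
    have hm' : F ∈ (E.ideal.map (Ideal.Quotient.mk (Ideal.span {Q}))).comap
        (Ideal.Quotient.mk (Ideal.span {Q})) := hm
    rwa [Ideal.comap_map_of_surjective _ Ideal.Quotient.mk_surjective, ← RingHom.ker_eq_comap_bot,
      Ideal.mk_ker, sup_eq_left.2 ((Ideal.span_singleton_le_iff_mem _).2 E.mem)] at hm'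
  have hu : IsUnit (algebraMap (CoordRing Q) (Localization.AtPrime E.coordIdeal)
      (Ideal.Quotient.mk (Ideal.span {Q}) F)) :=
    IsLocalization.map_units (M := E.coordIdeal.primeCompl) _ ⟨_, hF'⟩
  exact ordNat_of_isUnit hu

/-- A form not vanishing identically on the surface vanishes along finitely many curves only. -/
theorem finite_support_ord {Q F : MvPolynomial (Fin 4) k} (hQ : Prime Q) (hF : ¬ Q ∣ F) :
    (Function.support fun E : PrimeDivisor Q => (E.ord F : ℤ)).Finite := by
  have hfin := Ideal.finite_minimalPrimes_of_isNoetherianRing (MvPolynomial (Fin 4) k)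
    (Ideal.span {Q, F})
  refine Set.Finite.of_finite_image (f := PrimeDivisor.ideal) (hfin.subset ?_)
    (fun E _ E' _ h => PrimeDivisor.ext h)
  rintro _ ⟨E, hE, rfl⟩
  have hFE : F ∈ E.ideal := E.mem_of_ord_ne_zero (by simpa using hE)
  have hle : Ideal.span {Q, F} ≤ E.ideal := by
    rw [Ideal.span_le]
    rintro x (rfl | rfl)
    · exact E.mem
    · exact hFE
  obtain ⟨p, hp, hpE⟩ := Ideal.exists_minimalPrimes_le hle
  rcases hpE.eq_or_lt with h | h
  · rwa [← h]
  exfalso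
  have : p.IsPrime := hp.isPrime
  have : (Ideal.span {Q}).IsPrime := (Ideal.span_singleton_prime hQ.ne_zero).2 hQ
  have hQp : Q ∈ p := hp.le (Ideal.subset_span (by simp))
  have hFp : F ∈ p := hp.le (Ideal.subset_span (by simp))
  have h0 : (⊥ : Ideal (MvPolynomial (Fin 4) k)) < Ideal.span {Q} := by
    rw [bot_lt_iff_ne_bot, Ne, Ideal.span_singleton_eq_bot]
    exact hQ.ne_zero
  have h1 : Ideal.span {Q} < p := by
    refine lt_of_le_of_ne ((Ideal.span_singleton_le_iff_mem _).2 hQp) fun h' => hF ?_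
    rw [← h'] at hFp
    exact Ideal.mem_span_singleton.1 hFp
  have e0 := Ideal.height_add_one_le_of_lt_of_isPrime h0
  have e1 := Ideal.height_add_one_le_of_lt_of_isPrime h1
  have e2 := Ideal.height_add_one_le_of_lt_of_isPrime h
  rw [E.height_eq] at e2
  have : (3 : ℕ∞) ≤ 2 := by
    calc (3 : ℕ∞) = 0 + 1 + 1 + 1 := by norm_num
      _ ≤ (⊥ : Ideal (MvPolynomial (Fin 4) k)).height + 1 + 1 + 1 := by gcongr; exact bot_le
      _ ≤ (Ideal.span {Q}).height + 1 + 1 := by gcongr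
      _ ≤ p.height + 1 := by gcongr
      _ ≤ 2 := e2
  exact absurd this (by decide)

/-- The divisor cut out on the integral surface `Q = 0` by a form `F` that does not vanish
identically on it. -/
def formDivisor {Q F : MvPolynomial (Fin 4) k} (hQ : Prime Q) (hF : ¬ Q ∣ F) : Divisor Q :=
  Finsupp.ofSupportFinite (fun E => (E.ord F : ℤ)) (finite_support_ord hQ hF)

/-- Linear equivalence: `D - D'` is the divisor of a nonzero rational function `F / G` on the
surface, `F` and `G` being forms of the same degree. -/
def LinearlyEquivalent {Q : MvPolynomial (Fin 4) k} (hQ : Prime Q) (D D' : Divisor Q) : Prop :=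
  ∃ (n : ℕ) (F G : MvPolynomial (Fin 4) k) (hF : ¬ Q ∣ F) (hG : ¬ Q ∣ G),
    F.IsHomogeneous n ∧ G.IsHomogeneous n ∧
      D - D' = formDivisor hQ hF - formDivisor hQ hG

end QuadricSurface

end

/-! The homogeneous coordinate ring of an elliptic quadric X is factorial over k: x₂ is prime
because setting x₂ = 0 leaves the irreducible form f, and after inverting x₂ one can solve for x₃,
so Nagata's criterion applies. Hence a prime divisor D linearly equivalent to sH has ideal (Q, Y)
for a form Y of degree s (`exists_ideal_eq_span_of_linearlyEquivalent`). It remains to bound the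
common zeros of Q and Y. They are counted as vectors of k⁴: n points contribute at least n(q - 1) +
1 vectors.

For s = 2, consider the quadrics Y + cQ with c in k. As (Q, Y) is prime and has no nonzero elements
of degree below 2, no member is divisible by a linear form. So none contains a plane, and each has
at most q³ + q² - q zeros (`card_zeros_add_card_le`). Summing over c and using #X(k) ≤ q² + 1 gives
#D(k) ≤ 2q.

For s ≥ 3 and q + 1 ≤ 2s - 2, the bound #X(k) ≤ q² + 1 suffices. Otherwise s < q. On the chart x₂ =
1 put u = x - αy and v = x - α^q y with α a root of f(x, 1), so that f = auv. Then Y has degree at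
most s in u and in v, and v = u^q at rational points. Substituting gives a polynomial in u of degree
at most s(q + 1), which is nonzero because s < q. The chart misses only one rational point of X, so
#D(k) ≤ s(q + 1) + 1 ≤ q(2s - 2). -/

open scoped LinearAlgebra.Projectivization

noncomputable section

namespace QuadricSurface

/-! ### Factoriality of the homogeneous coordinate ring -/

section Factoriality

/-- Nagata's criterion, in the form: if `A` is noetherian, `x` is prime in `A` and every element of
`A` lies, up to a power of `x`, in a factorial subring containing `x`, then `A` is factorial. -/
theorem uniqueFactorizationMonoid_of_prime_of_subring {R A : Type*} [CommRing R] [IsDomain R]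
    [UniqueFactorizationMonoid R] [CommRing A] [IsDomain A] [IsNoetherianRing A] (i : R →+* A)
    (hi : Function.Injective i) (x : R) (hx : Prime (i x))
    (h : ∀ a, ∃ (n : ℕ) (r : R), i x ^ n * a = i r) : UniqueFactorizationMonoid A := by
  -- Kaplansky's criterion: every nonzero prime ideal must contain a prime element.
  refine UniqueFactorizationMonoid.iff_exists_prime_mem_of_isPrime.2 fun P hP0 hP => ?_
  by_cases hxP : i x ∈ P
  · exact ⟨_, hxP, hx⟩
  obtain ⟨a, haP, ha0⟩ := Submodule.exists_mem_ne_zero_of_ne_bot hP0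
  have hcomap : P.comap i ≠ ⊥ := by
    obtain ⟨n, r, hr⟩ := h a
    intro hb
    have hrP : r ∈ P.comap i := by
      rw [Ideal.mem_comap, ← hr]
      exact P.mul_mem_left _ haP
    rw [hb, Ideal.mem_bot] at hrP
    rw [hrP, map_zero] at hr
    exact (mul_ne_zero (pow_ne_zero _ hx.ne_zero) ha0) hr
  obtain ⟨p, hpP, hp⟩ := (hP.comap i).exists_mem_prime_of_ne_bot hcomap
  have hpx : ∀ n, ¬ p ∣ x ^ n := fun n hd =>
    hxP ((hP.comap i).mem_of_pow_mem n ((P.comap i).mem_of_dvd hd hpP))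
  have hip : i p ≠ 0 := by
    rw [Ne, map_eq_zero_iff i hi]; exact hp.ne_zero
  -- A prime p of R inside P may acquire factors x in A. Removing them leaves b, which is the prime
  -- element sought.
  obtain ⟨m, b, hxb, hb⟩ := WfDvdMonoid.max_power_factor hip hx.irreducible
  have hbP : b ∈ P := by
    have : i x ^ m * b ∈ P := hb ▸ hpP
    exact (hP.mem_or_mem this).resolve_left fun h' => hxP (hP.mem_of_pow_mem _ h')
  have hcancel : ∀ (n : ℕ) (c : A), b ∣ i x ^ n * c → b ∣ c := by
    rintro n c ⟨d, hd⟩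
    have : i x ^ n ∣ d := by
      refine hx.pow_dvd_of_dvd_mul_left n hxb ⟨c, hd.symm⟩
    obtain ⟨e, rfl⟩ := this
    refine ⟨e, mul_left_cancel₀ (pow_ne_zero n hx.ne_zero) ?_⟩
    rw [hd]; ring
  have hkey : ∀ c r n, i x ^ n * c = i r → p ∣ r → b ∣ c := by
    rintro c _ n hc ⟨d, rfl⟩
    refine hcancel n c ⟨i x ^ m * i d, ?_⟩
    rw [hc, map_mul, hb]; ring
  refine ⟨b, hbP, ?_, fun hu => hP.ne_top (P.eq_top_of_isUnit_mem hbP hu), ?_⟩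
  · rintro rfl
    exact hxb (dvd_zero _)
  · rintro c d ⟨e, he⟩
    obtain ⟨n₁, r₁, h₁⟩ := h c
    obtain ⟨n₂, r₂, h₂⟩ := h d
    obtain ⟨n₃, r₃, h₃⟩ := h e
    -- Clearing powers of x turns b ∣ cd into a divisibility by p in R, where p is prime and does
    -- not divide powers of x.
    have : r₁ * r₂ * x ^ (m + n₃) = x ^ (n₁ + n₂) * (p * r₃) := by
      apply hi
      simp only [map_mul, map_pow, ← h₁, ← h₂, ← h₃]
      rw [hb]
      linear_combination i x ^ (n₁ + n₂ + m + n₃) * he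
    have hd : p ∣ r₁ * r₂ * x ^ (m + n₃) := ⟨x ^ (n₁ + n₂) * r₃, by rw [this]; ring⟩
    rcases hp.dvd_or_dvd ((hp.dvd_or_dvd hd).resolve_right (hpx _)) with h' | h'
    · exact Or.inl (hkey _ _ _ h₁ h')
    · exact Or.inr (hkey _ _ _ h₂ h')

variable {k : Type*} [Field k]

/-- The normal form `f(x₀, x₁) + x₂ x₃`. -/
abbrev normalForm (a b c : k) : MvPolynomial (Fin 4) k :=
  binaryForm a b c + MvPolynomial.X 2 * MvPolynomial.X 3

/-- The binary quadratic form as a function. -/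
def binaryEval {A : Type*} [CommRing A] [Algebra k A] (a b c : k) (x y : A) : A :=
  algebraMap k A a * x ^ 2 + algebraMap k A b * (x * y) + algebraMap k A c * y ^ 2

theorem aeval_binaryForm {A : Type*} [CommRing A] [Algebra k A] (a b c : k) (v : Fin 4 → A) :
    MvPolynomial.aeval v (binaryForm a b c) = binaryEval a b c (v 0) (v 1) := by
  simp [binaryForm, binaryEval]

theorem prime_X_two_normalForm {a b c : k} (hf : Irreducible (binaryForm a b c)) :
    Prime (Ideal.Quotient.mk (Ideal.span {normalForm a b c})
      (MvPolynomial.X 2 : MvPolynomial (Fin 4) k)) := by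
  set Q := normalForm a b c with hQ
  -- Setting x₂ = 0 sends Q to f, so divisibility by x₂ modulo Q becomes divisibility by the prime
  -- f.
  let e : MvPolynomial (Fin 4) k →ₐ[k] MvPolynomial (Fin 4) k :=
    MvPolynomial.aeval (Function.update MvPolynomial.X 2 0)
  have heX : e (MvPolynomial.X 2) = 0 := by simp [e]
  have hef : e (binaryForm a b c) = binaryForm a b c := by
    simp [e, Function.update, binaryForm, MvPolynomial.algebraMap_eq]
  have heQ : e Q = binaryForm a b c := by
    rw [hQ, map_add, map_mul, heX, hef, zero_mul, add_zero]
  have hsub : ∀ A, ∃ B, A = e A + MvPolynomial.X 2 * B := by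
    intro A
    induction A using MvPolynomial.induction_on with
    | C r => exact ⟨0, by simp [e]⟩
    | add p q hp hq =>
      obtain ⟨B, hB⟩ := hp
      obtain ⟨C, hC⟩ := hq
      exact ⟨B + C, by rw [map_add]; linear_combination hB + hC⟩
    | mul_X p i hp =>
      obtain ⟨B, hB⟩ := hp
      by_cases hi : i = 2
      · subst hi
        exact ⟨p, by rw [map_mul, heX]; ring⟩
      · refine ⟨B * MvPolynomial.X i, ?_⟩
        have : e (MvPolynomial.X i) = MvPolynomial.X i := by simp [e, hi]
        rw [map_mul, this]
        linear_combination MvPolynomial.X i * hB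
  have hdvd : ∀ A, Ideal.Quotient.mk (Ideal.span {Q}) (MvPolynomial.X 2) ∣
      Ideal.Quotient.mk (Ideal.span {Q}) A ↔ binaryForm a b c ∣ e A := by
    intro A
    constructor
    · rintro ⟨B, hB⟩
      obtain ⟨B, rfl⟩ := Ideal.Quotient.mk_surjective B
      rw [← map_mul, Ideal.Quotient.eq, Ideal.mem_span_singleton] at hB
      obtain ⟨C, hC⟩ := hB
      refine ⟨e C, ?_⟩
      have := congrArg e hC
      rwa [map_sub, map_mul, heX, zero_mul, sub_zero, map_mul, heQ] at this
    · rintro ⟨C, hC⟩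
      obtain ⟨B, hB⟩ := hsub A
      refine ⟨Ideal.Quotient.mk _ (B - MvPolynomial.X 3 * C), ?_⟩
      rw [← map_mul, Ideal.Quotient.eq, Ideal.mem_span_singleton]
      refine ⟨C, ?_⟩
      rw [hQ, normalForm]
      linear_combination hB + hC
  have hfp := hf.prime
  refine ⟨?_, ?_, ?_⟩
  -- If x₂ = QC, then setting x₂ = 0 shows x₂ ∣ C. Cancelling x₂ makes Q, and hence f, a unit.
  · intro h0
    rw [Ideal.Quotient.eq_zero_iff_mem, Ideal.mem_span_singleton] at h0
    obtain ⟨C, hC⟩ := h0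
    have h1 := congrArg e hC
    rw [heX, map_mul, heQ] at h1
    have h2 : e C = 0 := (mul_eq_zero.1 h1.symm).resolve_left hfp.ne_zero
    obtain ⟨B, hB⟩ := hsub C
    rw [h2, zero_add] at hB
    have h3 : (1 : MvPolynomial (Fin 4) k) = Q * B := by
      apply mul_left_cancel₀ (MvPolynomial.X_ne_zero (R := k) (2 : Fin 4))
      linear_combination hC + Q * hB
    have h4 := congrArg e h3
    rw [map_one, map_mul, heQ] at h4
    exact hf.not_isUnit (IsUnit.of_mul_eq_one _ h4.symm)
  · intro hu
    have := (hdvd 1).1 (by rw [map_one]; exact hu.dvd)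
    rw [map_one] at this
    exact hf.not_isUnit (isUnit_of_dvd_one this)
  · intro A B hAB
    obtain ⟨A, rfl⟩ := Ideal.Quotient.mk_surjective A
    obtain ⟨B, rfl⟩ := Ideal.Quotient.mk_surjective B
    rw [← map_mul, hdvd, map_mul] at hAB
    rw [hdvd, hdvd]
    exact hfp.dvd_or_dvd hAB

/-- Every polynomial is, modulo `f(x₀, x₁) + x₂ x₃` and up to a power of `x₂`, a polynomial in
`x₀, x₁, x₂`. -/
theorem exists_X_two_pow_mul_sub_rename (a b c : k) (A : MvPolynomial (Fin 4) k) :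
    ∃ (n : ℕ) (r : MvPolynomial (Fin 3) k), normalForm a b c ∣
      MvPolynomial.X 2 ^ n * A - MvPolynomial.rename Fin.castSucc r := by
  have hx : MvPolynomial.rename Fin.castSucc (MvPolynomial.X 2 : MvPolynomial (Fin 3) k)
      = (MvPolynomial.X 2 : MvPolynomial (Fin 4) k) := by
    rw [MvPolynomial.rename_X]; rfl
  induction A using MvPolynomial.induction_on with
  | C r => exact ⟨0, MvPolynomial.C r, by simp⟩
  | add p q hp hq =>
    obtain ⟨n, r, B, hB⟩ := hp
    obtain ⟨m, t, C, hC⟩ := hq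
    refine ⟨n + m, MvPolynomial.X 2 ^ m * r + MvPolynomial.X 2 ^ n * t,
      MvPolynomial.X 2 ^ m * B + MvPolynomial.X 2 ^ n * C, ?_⟩
    simp only [map_add, map_mul, map_pow, hx]
    linear_combination MvPolynomial.X 2 ^ m * hB + MvPolynomial.X 2 ^ n * hC
  | mul_X p i hp =>
    obtain ⟨n, r, B, hB⟩ := hp
    refine Fin.lastCases ?_ (fun j => ?_) i
    -- A factor x₃ costs one more power of x₂: modulo Q, x₂x₃ is -f(x₀, x₁).
    · refine ⟨n + 1, - r * (MvPolynomial.C a * MvPolynomial.X 0 ^ 2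
          + MvPolynomial.C b * (MvPolynomial.X 0 * MvPolynomial.X 1)
          + MvPolynomial.C c * MvPolynomial.X 1 ^ 2),
        B * (MvPolynomial.X 2 * MvPolynomial.X 3) + MvPolynomial.rename Fin.castSucc r, ?_⟩
      have h0 : (Fin.last 3) = 3 := rfl
      simp only [map_add, map_mul, map_pow, map_neg, MvPolynomial.rename_X,
        MvPolynomial.rename_C, h0, normalForm, binaryForm] at hB ⊢
      simp only [Fin.castSucc_zero, Fin.castSucc_one]
      linear_combination MvPolynomial.X 2 * MvPolynomial.X 3 * hB
    · refine ⟨n, r * MvPolynomial.X j, B * MvPolynomial.X j.castSucc, ?_⟩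
      rw [map_mul, MvPolynomial.rename_X]
      linear_combination MvPolynomial.X j.castSucc * hB

/-- The last coordinate solves Q = 0 for x₃. With algebraically independent t this is the generic
point of the cone over the quadric. -/
theorem aeval_normalForm_snoc {L : Type*} [Field L] [Algebra k L] (a b c : k) {t : Fin 3 → L}
    (ht2 : t 2 ≠ 0) :
    MvPolynomial.aeval (Fin.snoc t (- binaryEval a b c (t 0) (t 1) / t 2) : Fin 4 → L)
      (normalForm a b c) = 0 := by
  set v : Fin 4 → L := Fin.snoc t (- binaryEval a b c (t 0) (t 1) / t 2) with hv
  have hv0 : v 0 = t 0 := Fin.snoc_castSucc (α := fun _ => L) _ t 0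
  have hv1 : v 1 = t 1 := Fin.snoc_castSucc (α := fun _ => L) _ t 1
  have hv2 : v 2 = t 2 := Fin.snoc_castSucc (α := fun _ => L) _ t 2
  have hv3 : v 3 = - binaryEval a b c (t 0) (t 1) / t 2 := Fin.snoc_last (α := fun _ => L) _ t
  rw [map_add, aeval_binaryForm, map_mul, MvPolynomial.aeval_X, MvPolynomial.aeval_X,
    hv0, hv1, hv2, hv3]
  field_simp
  ring

/-- If `t₀, t₁, t₂` are algebraically independent, then the polynomials vanishing at
`(t₀, t₁, t₂, - f(t₀, t₁) / t₂)` are the multiples of `f(x₀, x₁) + x₂ x₃`. -/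
theorem normalForm_dvd_of_aeval_eq_zero {a b c : k} (hf : Irreducible (binaryForm a b c))
    {L : Type*} [Field L] [Algebra k L] {t : Fin 3 → L} (ht : AlgebraicIndependent k t)
    {A : MvPolynomial (Fin 4) k}
    (hA : MvPolynomial.aeval (Fin.snoc t (- binaryEval a b c (t 0) (t 1) / t 2) : Fin 4 → L) A
      = 0) : normalForm a b c ∣ A := by
  set v : Fin 4 → L := Fin.snoc t (- binaryEval a b c (t 0) (t 1) / t 2) with hv
  have hQ0 : MvPolynomial.aeval v (normalForm a b c) = 0 :=
    aeval_normalForm_snoc a b c (ht.ne_zero 2)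
  obtain ⟨n, r, B, hB⟩ := exists_X_two_pow_mul_sub_rename a b c A
  have hr : r = 0 := by
    have h1 := congrArg (MvPolynomial.aeval v) hB
    rw [map_sub, map_mul, hA, map_mul, hQ0, MvPolynomial.aeval_rename, mul_zero, zero_mul,
      zero_sub, neg_eq_zero] at h1
    have h2 : v ∘ Fin.castSucc = t := by
      funext j
      exact Fin.snoc_castSucc (α := fun _ => L) _ t j
    rw [h2] at h1
    exact (injective_iff_map_eq_zero _).1 ht r h1
  rw [hr, map_zero, sub_zero] at hB
  have hp := (irreducible_normalForm hf).prime
  -- Now Q divides x₂ⁿA, and the prime Q does not divide x₂.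
  refine (hp.dvd_or_dvd ⟨B, hB⟩).resolve_left fun hd => ?_
  have := prime_X_two_normalForm hf
  apply this.ne_zero
  rw [Ideal.Quotient.eq_zero_iff_mem, Ideal.mem_span_singleton]
  exact hp.dvd_of_dvd_pow hd

/-- Nagata's criterion with the prime x₂ and the subring k[x₀, x₁, x₂], which embeds because a
polynomial in its kernel vanishes at the generic point. -/
theorem uniqueFactorizationMonoid_normalForm {a b c : k} (hf : Irreducible (binaryForm a b c)) :
    UniqueFactorizationMonoid (CoordRing (normalForm a b c)) := by
  have hp := (irreducible_normalForm hf).prime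
  have : (Ideal.span {normalForm a b c}).IsPrime := (Ideal.span_singleton_prime hp.ne_zero).2 hp
  let i : MvPolynomial (Fin 3) k →+* CoordRing (normalForm a b c) :=
    (Ideal.Quotient.mk _).comp (MvPolynomial.rename Fin.castSucc).toRingHom
  have hi2 : i (MvPolynomial.X 2) = Ideal.Quotient.mk _ (MvPolynomial.X 2) := by
    simp only [i, RingHom.comp_apply, AlgHom.toRingHom_eq_coe, RingHom.coe_coe,
      MvPolynomial.rename_X]
    rfl
  refine uniqueFactorizationMonoid_of_prime_of_subring i ?_ (MvPolynomial.X 2) ?_ ?_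
  · let L := FractionRing (MvPolynomial (Fin 3) k)
    let t : Fin 3 → L := fun j => algebraMap (MvPolynomial (Fin 3) k) L (MvPolynomial.X j)
    have ht : AlgebraicIndependent k t := by
      have h1 : AlgebraicIndependent k (MvPolynomial.X : Fin 3 → MvPolynomial (Fin 3) k) :=
        MvPolynomial.algebraicIndependent_X _ _
      exact h1.map' (f := IsScalarTower.toAlgHom k (MvPolynomial (Fin 3) k) L)
        (FaithfulSMul.algebraMap_injective (MvPolynomial (Fin 3) k) L)
    rw [injective_iff_map_eq_zero]
    intro r hr
    have hd : normalForm a b c ∣ MvPolynomial.rename Fin.castSucc r :=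
      Ideal.mem_span_singleton.1 (Ideal.Quotient.eq_zero_iff_mem.1 hr)
    obtain ⟨B, hB⟩ := hd
    let v : Fin 4 → L := Fin.snoc t (- binaryEval a b c (t 0) (t 1) / t 2)
    have hQ0 : MvPolynomial.aeval v (normalForm a b c) = 0 :=
      aeval_normalForm_snoc a b c (ht.ne_zero 2)
    have h1 := congrArg (MvPolynomial.aeval v) hB
    rw [map_mul, hQ0, MvPolynomial.aeval_rename, zero_mul] at h1
    have h2 : v ∘ Fin.castSucc = t := by
      funext j
      exact Fin.snoc_castSucc (α := fun _ => L) _ t j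
    rw [h2] at h1
    exact (injective_iff_map_eq_zero _).1 ht r h1
  · rw [hi2]
    exact prime_X_two_normalForm hf
  · intro A
    obtain ⟨A, rfl⟩ := Ideal.Quotient.mk_surjective A
    obtain ⟨n, r, h⟩ := exists_X_two_pow_mul_sub_rename a b c A
    refine ⟨n, r, ?_⟩
    rw [hi2, ← map_pow, ← map_mul]
    exact Ideal.Quotient.eq.2 (Ideal.mem_span_singleton.2 h)

/-- The invertible linear substitution `p ↦ p(g x)`. -/
def linearSubst (g : GL (Fin 4) k) : MvPolynomial (Fin 4) k ≃ₐ[k] MvPolynomial (Fin 4) k :=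
  AlgEquiv.ofAlgHom (MvPolynomial.bind₁ (g : Matrix (Fin 4) (Fin 4) k).toMvPolynomial)
    (MvPolynomial.bind₁ ((g⁻¹ : GL (Fin 4) k) : Matrix (Fin 4) (Fin 4) k).toMvPolynomial)
    (AlgHom.ext fun p => bind₁_bind₁_of_mul_eq_one (Units.inv_mul g) p)
    (AlgHom.ext fun p => bind₁_bind₁_of_mul_eq_one (Units.mul_inv g) p)

theorem linearSubst_apply (g : GL (Fin 4) k) (p : MvPolynomial (Fin 4) k) :
    linearSubst g p =
      MvPolynomial.bind₁ (g : Matrix (Fin 4) (Fin 4) k).toMvPolynomial p := rfl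

theorem isHomogeneous_linearSubst (g : GL (Fin 4) k) {p : MvPolynomial (Fin 4) k} {n : ℕ}
    (hp : p.IsHomogeneous n) : (linearSubst g p).IsHomogeneous n := by
  have := hp.aeval (fun i => (g : Matrix (Fin 4) (Fin 4) k).toMvPolynomial i)
    (fun i => Matrix.toMvPolynomial_isHomogeneous _ i)
  rwa [one_mul] at this

theorem linearSubst_symm (g : GL (Fin 4) k) : (linearSubst g).symm = linearSubst g⁻¹ := by
  ext1 p
  rfl

theorem eval_linearSubst (g : GL (Fin 4) k) (p : MvPolynomial (Fin 4) k) (v : Fin 4 → k) :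
    MvPolynomial.eval v (linearSubst g p)
      = MvPolynomial.eval ((g : Matrix (Fin 4) (Fin 4) k).mulVec v) p := by
  rw [linearSubst_apply, ← MvPolynomial.coe_aeval_eq_eval, ← MvPolynomial.coe_aeval_eq_eval]
  simp only [RingHom.coe_coe, MvPolynomial.aeval_bind₁]
  congr 2
  funext i
  simp [Matrix.toMvPolynomial_eval_eq_apply]

theorem isHomogeneous_binaryForm (a b c : k) : (binaryForm a b c).IsHomogeneous 2 := by
  have hX : ∀ i j : Fin 4,
      (MvPolynomial.X i * MvPolynomial.X j : MvPolynomial (Fin 4) k).IsHomogeneous 2 :=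
    fun i j => (MvPolynomial.isHomogeneous_X k i).mul (MvPolynomial.isHomogeneous_X k j)
  refine (((?_ : MvPolynomial.IsHomogeneous _ _).add ?_).add ?_)
  · rw [pow_two]; exact (hX _ _).C_mul _
  · exact (hX _ _).C_mul _
  · rw [pow_two]; exact (hX _ _).C_mul _

theorem IsEllipticQuadric.isHomogeneous {Q : MvPolynomial (Fin 4) k} (hQ : IsEllipticQuadric Q) :
    Q.IsHomogeneous 2 := by
  obtain ⟨g, a, b, c, -, hg⟩ := hQ
  rw [← linearSubst_apply, ← AlgEquiv.eq_symm_apply, linearSubst_symm] at hg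
  rw [hg]
  exact isHomogeneous_linearSubst _ ((isHomogeneous_binaryForm a b c).add
    ((MvPolynomial.isHomogeneous_X k _).mul (MvPolynomial.isHomogeneous_X k _)))

theorem IsEllipticQuadric.isDomain {Q : MvPolynomial (Fin 4) k} (hQ : IsEllipticQuadric Q) :
    IsDomain (CoordRing Q) :=
  (Ideal.Quotient.isDomain_iff_prime _).2
    ((Ideal.span_singleton_prime hQ.prime.ne_zero).2 hQ.prime)

/-- The homogeneous coordinate ring of an elliptic quadric is factorial. -/
theorem IsEllipticQuadric.uniqueFactorizationMonoid {Q : MvPolynomial (Fin 4) k}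
    (hQ : IsEllipticQuadric Q) : UniqueFactorizationMonoid (CoordRing Q) := by
  have := hQ.isDomain
  obtain ⟨g, a, b, c, hf, hg⟩ := hQ
  have := uniqueFactorizationMonoid_normalForm hf
  let e : CoordRing Q ≃+* CoordRing (normalForm a b c) :=
    Ideal.quotientEquiv _ _ (linearSubst g).toRingEquiv (by
      rw [Ideal.map_span, Set.image_singleton]
      congr 2
      exact hg.symm)
  exact e.symm.toMulEquiv.uniqueFactorizationMonoid this

end Factoriality

/-! ### Grading, prime divisors and orders of vanishing -/

section Divisors

attribute [local instance] MvPolynomial.gradedAlgebra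

theorem aeval_mul_of_isHomogeneous {R A σ : Type*} [CommSemiring R] [CommSemiring A] [Algebra R A]
    {F : MvPolynomial σ R} {n : ℕ} (hF : F.IsHomogeneous n) (v : σ → A) (r : A) :
    MvPolynomial.aeval (fun i => r * v i) F = r ^ n * MvPolynomial.aeval v F := by
  rw [MvPolynomial.aeval_def, MvPolynomial.aeval_def, MvPolynomial.eval₂_eq,
    MvPolynomial.eval₂_eq, Finset.mul_sum]
  refine Finset.sum_congr rfl fun d hd => ?_
  simp only [mul_pow, Finset.prod_mul_distrib, Finset.prod_pow_eq_pow_sum]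
  rw [hF.degree_eq_sum_deg_support hd]
  ring

variable {k : Type*} [Field k] {Q : MvPolynomial (Fin 4) k}

/-- An element of the homogeneous coordinate ring represented by a form of degree `n`. -/
def IsForm (a : CoordRing Q) (n : ℕ) : Prop :=
  ∃ F : MvPolynomial (Fin 4) k, F.IsHomogeneous n ∧ Ideal.Quotient.mk (Ideal.span {Q}) F = a

theorem IsForm.mul {a b : CoordRing Q} {m n : ℕ} (ha : IsForm a m) (hb : IsForm b n) :
    IsForm (a * b) (m + n) := by
  obtain ⟨F, hF, rfl⟩ := ha
  obtain ⟨G, hG, rfl⟩ := hb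
  exact ⟨F * G, hF.mul hG, map_mul _ _ _⟩

theorem isForm_one : IsForm (1 : CoordRing Q) 0 :=
  ⟨1, MvPolynomial.isHomogeneous_one _ _, map_one _⟩

theorem IsForm.pow {a : CoordRing Q} {m : ℕ} (ha : IsForm a m) (n : ℕ) :
    IsForm (a ^ n) (m * n) := by
  obtain ⟨F, hF, rfl⟩ := ha
  exact ⟨F ^ n, hF.pow n, map_pow _ _ _⟩

/-- The substitution `xᵢ ↦ xᵢ T`. -/
def scaleHom (Q : MvPolynomial (Fin 4) k) :
    MvPolynomial (Fin 4) k →ₐ[k] Polynomial (CoordRing Q) :=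
  MvPolynomial.aeval fun i =>
    Polynomial.X * Polynomial.C (Ideal.Quotient.mk (Ideal.span {Q}) (MvPolynomial.X i))

theorem scaleHom_apply {F : MvPolynomial (Fin 4) k} {n : ℕ} (hF : F.IsHomogeneous n) :
    scaleHom Q F = Polynomial.X ^ n * Polynomial.C (Ideal.Quotient.mk (Ideal.span {Q}) F) := by
  rw [scaleHom, aeval_mul_of_isHomogeneous hF]
  congr 1
  have : MvPolynomial.aeval (fun i : Fin 4 =>
      (Polynomial.C (Ideal.Quotient.mk (Ideal.span {Q}) (MvPolynomial.X i)) :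
        Polynomial (CoordRing Q)))
      = (Polynomial.CAlgHom (R := k)).comp (Ideal.Quotient.mkₐ k (Ideal.span {Q})) := by
    ext i
    simp
  rw [this]
  rfl

theorem coeff_scaleHom (F : MvPolynomial (Fin 4) k) (n : ℕ) :
    (scaleHom Q F).coeff n =
      Ideal.Quotient.mk (Ideal.span {Q}) (MvPolynomial.homogeneousComponent n F) := by
  conv_lhs => rw [← MvPolynomial.sum_homogeneousComponent F]
  rw [map_sum, Polynomial.finsetSum_coeff]
  simp only [scaleHom_apply (MvPolynomial.homogeneousComponent_isHomogeneous _ F),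
    Polynomial.coeff_mul_C, Polynomial.coeff_X_pow, ite_mul, one_mul, zero_mul]
  rw [Finset.sum_ite_eq]
  split_ifs with h
  · rfl
  · rw [MvPolynomial.homogeneousComponent_eq_zero, map_zero]
    rw [Finset.mem_range] at h
    omega

theorem eval_one_scaleHom (F : MvPolynomial (Fin 4) k) :
    (scaleHom Q F).eval 1 = Ideal.Quotient.mk (Ideal.span {Q}) F := by
  conv_rhs => rw [← MvPolynomial.sum_homogeneousComponent F]
  conv_lhs => rw [← MvPolynomial.sum_homogeneousComponent F]
  rw [map_sum, Polynomial.eval_finsetSum, map_sum]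
  refine Finset.sum_congr rfl fun i _ => ?_
  simp [scaleHom_apply (MvPolynomial.homogeneousComponent_isHomogeneous _ F)]

/-- The homomorphism `a ↦ a Tⁿ` (for forms `a` of degree `n`) that encodes the grading of the
homogeneous coordinate ring. -/
def gradingHom {d : ℕ} (hQ : Q.IsHomogeneous d) : CoordRing Q →+* Polynomial (CoordRing Q) :=
  Ideal.Quotient.lift (Ideal.span {Q}) (scaleHom Q).toRingHom fun a ha => by
    obtain ⟨b, rfl⟩ := Ideal.mem_span_singleton.1 ha
    have h0 : Ideal.Quotient.mk (Ideal.span {Q}) Q = 0 :=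
      Ideal.Quotient.eq_zero_iff_mem.2 (Ideal.mem_span_singleton_self Q)
    have : scaleHom Q Q = 0 := by rw [scaleHom_apply hQ, h0, map_zero, mul_zero]
    simp [this]

theorem gradingHom_mk {d : ℕ} (hQ : Q.IsHomogeneous d) (F : MvPolynomial (Fin 4) k) :
    gradingHom hQ (Ideal.Quotient.mk _ F) = scaleHom Q F := rfl

theorem IsForm.gradingHom_eq {d : ℕ} (hQ : Q.IsHomogeneous d) {a : CoordRing Q} {n : ℕ}
    (ha : IsForm a n) : gradingHom hQ a = Polynomial.X ^ n * Polynomial.C a := by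
  obtain ⟨F, hF, rfl⟩ := ha
  rw [gradingHom_mk, scaleHom_apply hF]

/-- Setting T = 1 recovers a as the sum of its homogeneous components, and only the n-th one
survives. -/
theorem isForm_of_gradingHom {d : ℕ} (hQ : Q.IsHomogeneous d) {a : CoordRing Q} {n : ℕ}
    (h : (gradingHom hQ a).natDegree = n) (h' : (gradingHom hQ a).natTrailingDegree = n) :
    IsForm a n := by
  obtain ⟨F, rfl⟩ := Ideal.Quotient.mk_surjective a
  rw [gradingHom_mk] at h h'
  refine ⟨_, MvPolynomial.homogeneousComponent_isHomogeneous n F, ?_⟩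
  rw [← coeff_scaleHom, ← eval_one_scaleHom F, Polynomial.eval_eq_sum_range,
    Finset.sum_eq_single_of_mem n]
  · simp
  · simp [h]
  · intro i hi hin
    rw [Finset.mem_range, h] at hi
    rw [Polynomial.coeff_eq_zero_of_lt_natTrailingDegree (by omega), zero_mul]

theorem IsForm.degree_unique {d : ℕ} (hQ : Q.IsHomogeneous d) {a : CoordRing Q} (ha : a ≠ 0)
    {m n : ℕ} (hm : IsForm a m) (hn : IsForm a n) : m = n := by
  have h := (hm.gradingHom_eq hQ).symm.trans (hn.gradingHom_eq hQ)
  have h1 := congrArg (fun p => Polynomial.coeff p m) h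
  by_contra hne
  simp [Polynomial.coeff_X_pow, hne] at h1
  exact ha h1

/-- The factors of a form are forms. -/
theorem IsForm.of_mul [IsDomain (CoordRing Q)] {d : ℕ} (hQ : Q.IsHomogeneous d)
    {a b : CoordRing Q} (hab : a * b ≠ 0) {n : ℕ} (h : IsForm (a * b) n) :
    ∃ i j, IsForm a i ∧ IsForm b j ∧ i + j = n := by
  have h1 := h.gradingHom_eq hQ
  rw [map_mul] at h1
  have hC : Polynomial.C (a * b) ≠ 0 := Polynomial.C_ne_zero.2 hab
  have hne : gradingHom hQ a * gradingHom hQ b ≠ 0 := by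
    rw [h1]
    exact mul_ne_zero (pow_ne_zero _ Polynomial.X_ne_zero) hC
  -- Degree and trailing degree are both additive and agree on the product, so they agree on each
  -- factor.
  have e1 := Polynomial.natDegree_mul (left_ne_zero_of_mul hne) (right_ne_zero_of_mul hne)
  have e2 := Polynomial.natTrailingDegree_mul (left_ne_zero_of_mul hne) (right_ne_zero_of_mul hne)
  have e3 : (gradingHom hQ a * gradingHom hQ b).natDegree = n := by
    rw [h1, mul_comm (Polynomial.X ^ n) (Polynomial.C (a * b)),
      Polynomial.natDegree_C_mul_X_pow _ _ hab]
  have e4 : (gradingHom hQ a * gradingHom hQ b).natTrailingDegree = n := by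
    rw [h1, mul_comm (Polynomial.X ^ n) (Polynomial.C (a * b)), Polynomial.C_mul_X_pow_eq_monomial,
      Polynomial.natTrailingDegree_monomial hab]
  have e5 := Polynomial.natTrailingDegree_le_natDegree (gradingHom hQ a)
  have e6 := Polynomial.natTrailingDegree_le_natDegree (gradingHom hQ b)
  exact ⟨_, _, isForm_of_gradingHom hQ rfl (by omega), isForm_of_gradingHom hQ rfl (by omega),
    by omega⟩

theorem IsForm.degree_eq_zero_of_isUnit [IsDomain (CoordRing Q)] {d : ℕ}
    (hQd : Q.IsHomogeneous d) {a : CoordRing Q} (ha : IsUnit a) {n : ℕ} (h : IsForm a n) : n = 0 := by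
  obtain ⟨b, hb⟩ := ha.exists_right_inv
  obtain ⟨i, j, hi, hj, hij⟩ := IsForm.of_mul hQd (a := a) (b := b) (n := 0)
    (by rw [hb]; exact one_ne_zero) (by rw [hb]; exact isForm_one)
  have := h.degree_unique hQd ha.ne_zero hi
  omega

theorem mk_eq_zero_iff_dvd {F : MvPolynomial (Fin 4) k} :
    Ideal.Quotient.mk (Ideal.span {Q}) F = 0 ↔ Q ∣ F := by
  rw [Ideal.Quotient.eq_zero_iff_mem, Ideal.mem_span_singleton]

/-- From the chain 0 < (Q) < P < P'. It forbids a prime strictly between (Q) and the height-two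
ideal of a curve. -/
theorem three_le_height_of_lt_of_lt {P P' : Ideal (MvPolynomial (Fin 4) k)} [P.IsPrime]
    [P'.IsPrime] (hQ : Prime Q) (h1 : Ideal.span {Q} < P) (h2 : P < P') : 3 ≤ P'.height := by
  have : (Ideal.span {Q}).IsPrime := (Ideal.span_singleton_prime hQ.ne_zero).2 hQ
  have h0 : (⊥ : Ideal (MvPolynomial (Fin 4) k)) < Ideal.span {Q} := by
    rw [bot_lt_iff_ne_bot, Ne, Ideal.span_singleton_eq_bot]
    exact hQ.ne_zero
  have e0 := Ideal.height_add_one_le_of_lt_of_isPrime h0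
  have e1 := Ideal.height_add_one_le_of_lt_of_isPrime h1
  have e2 := Ideal.height_add_one_le_of_lt_of_isPrime h2
  calc (3 : ℕ∞) = 0 + 1 + 1 + 1 := by norm_num
    _ ≤ (⊥ : Ideal (MvPolynomial (Fin 4) k)).height + 1 + 1 + 1 := by gcongr; exact bot_le
    _ ≤ (Ideal.span {Q}).height + 1 + 1 := by gcongr
    _ ≤ P.height + 1 := by gcongr
    _ ≤ P'.height := e2

theorem PrimeDivisor.eq_ideal_of_lt_of_le (hQ : Prime Q) (E : PrimeDivisor Q)
    {P : Ideal (MvPolynomial (Fin 4) k)} [P.IsPrime] (h1 : Ideal.span {Q} < P)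
    (h2 : P ≤ E.ideal) : P = E.ideal := by
  refine h2.eq_or_lt.resolve_right fun h => ?_
  have := three_le_height_of_lt_of_lt hQ h1 h
  rw [E.height_eq] at this
  exact absurd this (by decide)

theorem PrimeDivisor.span_lt_ideal (hQ : Prime Q) (E : PrimeDivisor Q) :
    Ideal.span {Q} < E.ideal := by
  refine lt_of_le_of_ne ((Ideal.span_singleton_le_iff_mem _).2 E.mem) fun h => ?_
  have h1 := Ideal.height_span_singleton_le_one hQ.not_isUnit
  rw [h, E.height_eq] at h1
  exact absurd h1 (by decide)

theorem PrimeDivisor.comap_coordIdeal (E : PrimeDivisor Q) :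
    E.coordIdeal.comap (Ideal.Quotient.mk (Ideal.span {Q})) = E.ideal := by
  rw [PrimeDivisor.coordIdeal, Ideal.comap_map_of_surjective _ Ideal.Quotient.mk_surjective,
    ← RingHom.ker_eq_comap_bot, Ideal.mk_ker,
    sup_eq_left.2 ((Ideal.span_singleton_le_iff_mem _).2 E.mem)]

theorem span_lt_comap_span_singleton {p : CoordRing Q} (hp : p ≠ 0) :
    Ideal.span {Q} < (Ideal.span {p}).comap (Ideal.Quotient.mk (Ideal.span {Q})) := by
  obtain ⟨F, rfl⟩ := Ideal.Quotient.mk_surjective p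
  refine lt_of_le_of_ne ?_ fun h => hp ?_
  · rw [Ideal.span_singleton_le_iff_mem, Ideal.mem_comap, mk_eq_zero_iff_dvd.2 dvd_rfl]
    exact zero_mem _
  · rw [Ideal.Quotient.eq_zero_iff_mem, h]
    exact Ideal.mem_span_singleton_self _

/-- On a factorial surface the ideal of every curve is principal. -/
theorem PrimeDivisor.exists_coordIdeal_eq_span [IsDomain (CoordRing Q)]
    [UniqueFactorizationMonoid (CoordRing Q)] (hQ : Prime Q) (E : PrimeDivisor Q) :
    ∃ p, Prime p ∧ E.coordIdeal = Ideal.span {p} := by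
  have h0 : E.coordIdeal ≠ ⊥ := by
    intro h
    apply (E.span_lt_ideal hQ).ne
    rw [← E.comap_coordIdeal, h, ← RingHom.ker_eq_comap_bot, Ideal.mk_ker]
  obtain ⟨p, hpE, hp⟩ := Ideal.IsPrime.exists_mem_prime_of_ne_bot
    (inferInstance : E.coordIdeal.IsPrime) h0
  refine ⟨p, hp, ?_⟩
  have := (Ideal.span_singleton_prime hp.ne_zero).2 hp
  have h := E.eq_ideal_of_lt_of_le hQ (span_lt_comap_span_singleton hp.ne_zero) (by
    rw [← E.comap_coordIdeal]
    exact Ideal.comap_mono ((Ideal.span_singleton_le_iff_mem _).2 hpE))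
  rw [PrimeDivisor.coordIdeal, ← h, Ideal.map_comap_of_surjective _ Ideal.Quotient.mk_surjective]

theorem comap_span_singleton_mk (F : MvPolynomial (Fin 4) k) :
    (Ideal.span {Ideal.Quotient.mk (Ideal.span {Q}) F}).comap (Ideal.Quotient.mk (Ideal.span {Q}))
      = Ideal.span {Q, F} := by
  rw [← Set.image_singleton, ← Ideal.map_span,
    Ideal.comap_map_of_surjective _ Ideal.Quotient.mk_surjective, ← RingHom.ker_eq_comap_bot,
    Ideal.mk_ker, Ideal.span_insert, sup_comm]

/-- A prime form cuts out a curve. -/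
theorem IsForm.exists_primeDivisor {d : ℕ} (hQd : Q.IsHomogeneous d) (hQ : Prime Q)
    {p : CoordRing Q} (hp : Prime p) {n : ℕ} (h : IsForm p n) :
    ∃ E : PrimeDivisor Q, E.coordIdeal = Ideal.span {p} := by
  obtain ⟨F, hF, rfl⟩ := h
  have hpr := (Ideal.span_singleton_prime hp.ne_zero).2 hp
  have hpr' := Ideal.IsPrime.comap (Ideal.Quotient.mk (Ideal.span {Q})) (hK := hpr)
  have hlt := span_lt_comap_span_singleton hp.ne_zero
  have hprQ : (Ideal.span {Q}).IsPrime := (Ideal.span_singleton_prime hQ.ne_zero).2 hQ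
  refine ⟨⟨_, hpr', ?_, ?_, ?_⟩, Ideal.map_comap_of_surjective _ Ideal.Quotient.mk_surjective _⟩
  · rw [comap_span_singleton_mk]
    refine Ideal.homogeneous_span _ _ ?_
    rintro x (rfl | rfl)
    · exact ⟨_, hQd⟩
    · exact ⟨_, hF⟩
  · exact hlt.le (Ideal.mem_span_singleton_self Q)
  -- Krull's height theorem for the two generators Q, F gives ≤ 2; the chain 0 < (Q) < P gives ≥ 2.
  · apply le_antisymm
    · have h1 : (Ideal.span {Ideal.Quotient.mk (Ideal.span {Q}) F}).comap
          (Ideal.Quotient.mk (Ideal.span {Q})) ∈ (Ideal.span {Q, F}).minimalPrimes := by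
        rw [← comap_span_singleton_mk, Ideal.minimalPrimes_eq_subsingleton_self]
        rfl
      refine (Ideal.height_le_card_of_mem_minimalPrimes_span (Set.toFinite _) h1).trans ?_
      exact_mod_cast (Set.ncard_insert_le Q {F}).trans (by rw [Set.ncard_singleton])
    · have h0 : (⊥ : Ideal (MvPolynomial (Fin 4) k)) < Ideal.span {Q} := by
        rw [bot_lt_iff_ne_bot, Ne, Ideal.span_singleton_eq_bot]
        exact hQ.ne_zero
      have e0 := Ideal.height_add_one_le_of_lt_of_isPrime h0
      have e1 := Ideal.height_add_one_le_of_lt_of_isPrime hlt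
      calc (2 : ℕ∞) = 0 + 1 + 1 := by norm_num
        _ ≤ (⊥ : Ideal (MvPolynomial (Fin 4) k)).height + 1 + 1 := by gcongr; exact bot_le
        _ ≤ (Ideal.span {Q}).height + 1 := by gcongr
        _ ≤ _ := e1

/-- The order of vanishing along a curve of an element of the homogeneous coordinate ring. -/
def PrimeDivisor.coordOrd (E : PrimeDivisor Q) (a : CoordRing Q) : ℕ :=
  ordNat (Localization.AtPrime E.coordIdeal) (algebraMap _ _ a)

theorem PrimeDivisor.coordOrd_mk (E : PrimeDivisor Q) (F : MvPolynomial (Fin 4) k) :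
    E.coordOrd (Ideal.Quotient.mk _ F) = E.ord F := rfl

/-- Here R/(x) is the residue field, of length 1, and the order is additive on products. The order
is thus the exponent of the uniformizer. -/
theorem ordNat_pow_mul_of_isUnit {R : Type*} [CommRing R] [IsDomain R] [IsLocalRing R] {x u : R}
    (hx0 : x ≠ 0) (hx : Ideal.span {x} = IsLocalRing.maximalIdeal R) (hu : IsUnit u) (n : ℕ) :
    ordNat R (x ^ n * u) = n := by
  have hx1 : Ring.ord R x = 1 := by
    rw [Ring.ord, Module.length_eq_one_iff, isSimpleModule_iff_isCoatom, hx]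
    exact Ideal.isMaximal_def.1 inferInstance
  rw [ordNat, Ring.ord_mul_of_isUnit_right hu,
    Ring.ord_pow (mem_nonZeroDivisors_of_ne_zero hx0), hx1]
  simp

theorem ordNat_localization_pow_mul {A : Type*} [CommRing A] [IsDomain A] {p u : A}
    (hp : Prime p) (I : Ideal A) [I.IsPrime] (hI : I = Ideal.span {p}) (hu : ¬ p ∣ u) (n : ℕ) :
    ordNat (Localization.AtPrime I) (algebraMap A (Localization.AtPrime I) (p ^ n * u)) = n := by
  subst hI
  have hinj := IsLocalization.injective (Localization.AtPrime (Ideal.span {p}))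
    (Ideal.span {p}).primeCompl_le_nonZeroDivisors
  have : IsDomain (Localization.AtPrime (Ideal.span {p})) :=
    IsLocalization.isDomain_localization (Ideal.span {p}).primeCompl_le_nonZeroDivisors
  rw [map_mul, map_pow]
  refine ordNat_pow_mul_of_isUnit ?_ ?_ ?_ n
  · rw [Ne, map_eq_zero_iff _ hinj]
    exact hp.ne_zero
  · rw [← Localization.AtPrime.map_eq_maximalIdeal, Ideal.map_span, Set.image_singleton]
  · exact IsLocalization.map_units (M := (Ideal.span {p}).primeCompl) _
      ⟨u, fun h => hu (Ideal.mem_span_singleton.1 h)⟩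

theorem PrimeDivisor.coordOrd_pow_mul [IsDomain (CoordRing Q)] (E : PrimeDivisor Q)
    {p : CoordRing Q} (hp : Prime p) (hE : E.coordIdeal = Ideal.span {p}) (n : ℕ)
    {u : CoordRing Q} (hu : ¬ p ∣ u) : E.coordOrd (p ^ n * u) = n :=
  ordNat_localization_pow_mul hp E.coordIdeal hE hu n

theorem PrimeDivisor.mem_of_coordOrd_ne_zero (E : PrimeDivisor Q) {a : CoordRing Q}
    (h : E.coordOrd a ≠ 0) : a ∈ E.coordIdeal := by
  obtain ⟨F, rfl⟩ := Ideal.Quotient.mk_surjective a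
  rw [E.coordOrd_mk] at h
  exact Ideal.mem_map_of_mem _ (E.mem_of_ord_ne_zero h)

section Factorial

variable [IsDomain (CoordRing Q)] [UniqueFactorizationMonoid (CoordRing Q)]

/-- The order along E is the multiplicity of the prime that generates the ideal of E. -/
theorem PrimeDivisor.coordOrd_mul (hQ : Prime Q) (E : PrimeDivisor Q) {a b : CoordRing Q}
    (ha : a ≠ 0) (hb : b ≠ 0) : E.coordOrd (a * b) = E.coordOrd a + E.coordOrd b := by
  obtain ⟨p, hp, hE⟩ := E.exists_coordIdeal_eq_span hQ
  obtain ⟨m, u, hu, rfl⟩ := WfDvdMonoid.max_power_factor ha hp.irreducible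
  obtain ⟨n, v, hv, rfl⟩ := WfDvdMonoid.max_power_factor hb hp.irreducible
  have : p ^ m * u * (p ^ n * v) = p ^ (m + n) * (u * v) := by ring
  rw [this, E.coordOrd_pow_mul hp hE _ hu, E.coordOrd_pow_mul hp hE _ hv,
    E.coordOrd_pow_mul hp hE]
  exact fun h => (hp.dvd_or_dvd h).elim hu hv

theorem PrimeDivisor.coordOrd_ne_zero_of_mem (hQ : Prime Q) (E : PrimeDivisor Q)
    {a : CoordRing Q} (ha : a ≠ 0) (h : a ∈ E.coordIdeal) : E.coordOrd a ≠ 0 := by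
  obtain ⟨p, hp, hE⟩ := E.exists_coordIdeal_eq_span hQ
  obtain ⟨m, u, hu, rfl⟩ := WfDvdMonoid.max_power_factor ha hp.irreducible
  rw [E.coordOrd_pow_mul hp hE _ hu]
  rintro rfl
  rw [hE, pow_zero, one_mul] at h
  exact hu (Ideal.mem_span_singleton.1 h)

theorem PrimeDivisor.coordOrd_pow (hQ : Prime Q) (E : PrimeDivisor Q) {a : CoordRing Q}
    (ha : a ≠ 0) (n : ℕ) : E.coordOrd (a ^ n) = n * E.coordOrd a := by
  induction n with
  | zero =>
    rw [pow_zero, zero_mul]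
    by_contra h
    exact (inferInstance : E.coordIdeal.IsPrime).ne_top
      ((Ideal.eq_top_iff_one _).2 (E.mem_of_coordOrd_ne_zero h))
  | succ n ih => rw [pow_succ, E.coordOrd_mul hQ (pow_ne_zero n ha) ha, ih]; ring

/-- Forms with the same divisor have the same degree. -/
theorem IsForm.degree_eq_of_coordOrd_eq {d : ℕ} (hQd : Q.IsHomogeneous d) (hQ : Prime Q)
    {a b : CoordRing Q} (ha0 : a ≠ 0) (hb0 : b ≠ 0) {m n : ℕ} (ha : IsForm a m) (hb : IsForm b n)
    (h : ∀ E : PrimeDivisor Q, E.coordOrd a = E.coordOrd b) : m = n := by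
  induction a using UniqueFactorizationMonoid.induction_on_prime generalizing b m n with
  | h₁ => exact absurd rfl ha0
  | h₂ a hu =>
    rw [ha.degree_eq_zero_of_isUnit hQd hu]
    symm
    refine hb.degree_eq_zero_of_isUnit hQd ?_
    -- A prime factor of a nonunit form b is a form and cuts out a curve along which b vanishes,
    -- while the unit a vanishes along no curve.
    by_contra hbu
    obtain ⟨p, hp, c, rfl⟩ := WfDvdMonoid.exists_irreducible_factor hbu hb0
    obtain ⟨i, j, hi, -, -⟩ := hb.of_mul hQd hb0
    obtain ⟨E, hE⟩ := hi.exists_primeDivisor hQd hQ hp.prime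
    refine E.coordOrd_ne_zero_of_mem hQ hb0 ?_ ((h E).symm.trans ?_)
    · rw [hE]
      exact Ideal.mem_span_singleton.2 (dvd_mul_right _ _)
    · by_contra h'
      exact (inferInstance : E.coordIdeal.IsPrime).ne_top
        (Ideal.eq_top_of_isUnit_mem _ (E.mem_of_coordOrd_ne_zero h') hu)
  | h₃ a p ha' hp ih =>
    obtain ⟨i, j, hi, hj, rfl⟩ := ha.of_mul hQd ha0
    obtain ⟨E, hE⟩ := hi.exists_primeDivisor hQd hQ hp
    have hpb : p ∣ b := by
      rw [← Ideal.mem_span_singleton, ← hE]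
      refine E.mem_of_coordOrd_ne_zero ?_
      rw [← h E]
      refine E.coordOrd_ne_zero_of_mem hQ ha0 ?_
      rw [hE]
      exact Ideal.mem_span_singleton.2 (dvd_mul_right _ _)
    obtain ⟨c, rfl⟩ := hpb
    have hc0 := right_ne_zero_of_mul hb0
    obtain ⟨i', j', hi', hj', rfl⟩ := hb.of_mul hQd hb0
    rw [hi.degree_unique hQd hp.ne_zero hi']
    congr 1
    refine ih ha' hc0 hj hj' fun E => ?_
    have := h E
    rw [E.coordOrd_mul hQ hp.ne_zero ha', E.coordOrd_mul hQ hp.ne_zero hc0] at this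
    omega

/-- On a factorial surface in `ℙ³`, a prime divisor linearly equivalent to `s` plane sections is
cut out by a form of degree `s`. -/
theorem exists_ideal_eq_span_of_linearlyEquivalent {d : ℕ} (hQd : Q.IsHomogeneous d)
    (hQ : Prime Q) {h : MvPolynomial (Fin 4) k} (hh : h.IsHomogeneous 1) (hQh : ¬ Q ∣ h) (s : ℕ)
    (D : PrimeDivisor Q)
    (hD : LinearlyEquivalent hQ (Finsupp.single D 1) (s • formDivisor hQ hQh)) :
    ∃ Y : MvPolynomial (Fin 4) k, Y.IsHomogeneous s ∧ ¬ Q ∣ Y ∧ D.ideal = Ideal.span {Q, Y} := by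
  obtain ⟨n, F, G, hF, hG, hFn, hGn, heq⟩ := hD
  obtain ⟨p, hp, hDp⟩ := D.exists_coordIdeal_eq_span hQ
  -- The homogeneous ideal of D contains a form outside (Q). The generator p divides it, so p is
  -- itself a form.
  have hform : ∃ m, IsForm p m := by
    obtain ⟨x, hxD, hxQ⟩ := SetLike.exists_of_lt (D.span_lt_ideal hQ)
    have : ∃ i, MvPolynomial.homogeneousComponent i x ∉ Ideal.span {Q} := by
      by_contra hcon
      push Not at hcon
      apply hxQ
      rw [← MvPolynomial.sum_homogeneousComponent x]
      exact Ideal.sum_mem _ fun i _ => hcon i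
    obtain ⟨i, hi⟩ := this
    have hiD : MvPolynomial.homogeneousComponent i x ∈ D.ideal :=
      MvPolynomial.homogeneousComponent_mem_of_mem D.isHomogeneous hxD i
    rw [← D.comap_coordIdeal, Ideal.mem_comap, hDp, Ideal.mem_span_singleton] at hiD
    obtain ⟨c, hc⟩ := hiD
    have hne : p * c ≠ 0 := by
      rw [← hc, Ne, Ideal.Quotient.eq_zero_iff_mem]
      exact hi
    have hpc : IsForm (p * c) i :=
      ⟨_, MvPolynomial.homogeneousComponent_isHomogeneous i x, hc⟩
    obtain ⟨m, _, hm, -, -⟩ := hpc.of_mul hQd hne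
    exact ⟨m, hm⟩
  obtain ⟨m, hm⟩ := hform
  have hF0 : Ideal.Quotient.mk (Ideal.span {Q}) F ≠ 0 := fun h => hF (mk_eq_zero_iff_dvd.1 h)
  have hG0 : Ideal.Quotient.mk (Ideal.span {Q}) G ≠ 0 := fun h => hG (mk_eq_zero_iff_dvd.1 h)
  have hh0 : Ideal.Quotient.mk (Ideal.span {Q}) h ≠ 0 := fun h => hQh (mk_eq_zero_iff_dvd.1 h)
  -- The divisor of p is D: a curve along which p vanishes has an ideal containing that of D, and by
  -- heights the two are equal.
  have hord : ∀ E : PrimeDivisor Q, (E.coordOrd p : ℤ) = Finsupp.single D (1 : ℤ) E := by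
    intro E
    by_cases hED : E = D
    · subst hED
      rw [Finsupp.single_eq_same]
      have := E.coordOrd_pow_mul hp hDp 1 (u := 1) (fun h' => hp.not_isUnit (isUnit_of_dvd_one h'))
      rw [pow_one, mul_one] at this
      rw [this, Nat.cast_one]
    · rw [Finsupp.single_eq_of_ne hED, Nat.cast_eq_zero]
      by_contra h'
      have hle : D.ideal ≤ E.ideal := by
        rw [← D.comap_coordIdeal, ← E.comap_coordIdeal, hDp]
        exact Ideal.comap_mono
          ((Ideal.span_singleton_le_iff_mem _).2 (E.mem_of_coordOrd_ne_zero h'))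
      exact hED (PrimeDivisor.ext (E.eq_ideal_of_lt_of_le hQ (D.span_lt_ideal hQ) hle).symm)
  -- With denominators cleared, pG and Fhˢ have the same divisor, hence the same degree.
  have hms : m + n = n + 1 * s := by
    refine IsForm.degree_eq_of_coordOrd_eq hQd hQ (mul_ne_zero hp.ne_zero hG0)
      (mul_ne_zero hF0 (pow_ne_zero s hh0)) (hm.mul ⟨G, hGn, rfl⟩)
      (IsForm.mul ⟨F, hFn, rfl⟩ (IsForm.pow ⟨h, hh, rfl⟩ s)) fun E => ?_
    have hE := DFunLike.congr_fun heq E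
    simp only [Finsupp.sub_apply, Finsupp.smul_apply, ← hord E] at hE
    have e : ∀ {A : MvPolynomial (Fin 4) k} (hA : ¬ Q ∣ A),
        formDivisor hQ hA E = (E.coordOrd (Ideal.Quotient.mk _ A) : ℤ) := fun _ => rfl
    rw [e, e, e, nsmul_eq_mul] at hE
    rw [E.coordOrd_mul hQ hp.ne_zero hG0, E.coordOrd_mul hQ hF0 (pow_ne_zero s hh0),
      E.coordOrd_pow hQ hh0]
    zify
    linarith
  obtain rfl : m = s := by omega
  obtain ⟨Y, hY, rfl⟩ := hm
  refine ⟨Y, hY, fun h' => hp.ne_zero (mk_eq_zero_iff_dvd.2 h'), ?_⟩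
  rw [← D.comap_coordIdeal, hDp, comap_span_singleton_mk]

end Factorial

end Divisors

/-! ### The case s = 2: pencils of quadrics -/

section Pencil

/-- A singular vector orthogonal to W can be added to W without leaving the totally singular
subspaces. Maximality therefore puts it in W, in every characteristic. -/
theorem exists_maximal_totallySingular {k V : Type*} [Field k]
    [AddCommGroup V] [Module k V] [FiniteDimensional k V] (B : QuadraticForm k V) :
    ∃ W : Submodule k V, (∀ w ∈ W, B w = 0) ∧
      ∀ v, B v = 0 → (∀ w ∈ W, QuadraticMap.polar B v w = 0) → v ∈ W := by
  obtain ⟨W, hW, hmax⟩ := set_has_maximal_iff_noetherian.2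
    (inferInstance : IsNoetherian k V) {W : Submodule k V | ∀ w ∈ W, B w = 0}
    ⟨⊥, fun w hw => by rw [(Submodule.mem_bot k).1 hw, QuadraticMap.map_zero]⟩
  refine ⟨W, hW, fun v hv hvW => ?_⟩
  by_contra hvn
  refine hmax (W ⊔ Submodule.span k {v}) ?_ ?_
  · intro x hx
    obtain ⟨w, hw, y, hy, rfl⟩ := Submodule.mem_sup.1 hx
    obtain ⟨a, rfl⟩ := Submodule.mem_span_singleton.1 hy
    rw [QuadraticMap.map_add B, hW w hw, QuadraticMap.map_smul, hv, QuadraticMap.polar_smul_right,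
      QuadraticMap.polar_comm, hvW w hw]
    simp
  · refine lt_of_le_of_ne le_sup_left fun h => hvn ?_
    rw [h]
    exact Submodule.mem_sup_right (Submodule.mem_span_singleton_self v)

section QuadraticForm

variable {k V : Type*} [Field k] [Fintype k] [AddCommGroup V] [Module k V]

theorem card_mul_card_fiber [Fintype V] [DecidableEq k] {f : V →ₗ[k] k} (hf : f ≠ 0) (c : k) :
    Fintype.card k * (Finset.univ.filter fun v => f v = c).card = Fintype.card V := by
  classical
  have hsurj := LinearMap.surjective hf
  rw [← Finset.card_univ (α := V),
    Finset.card_eq_sum_card_fiberwise (s := (Finset.univ : Finset V)) (f := f)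
      (t := Finset.univ) (by simp [Set.MapsTo])]
  rw [Finset.sum_congr rfl fun d _ =>
    AddMonoidHom.card_fiber_eq_of_mem_range f (hsurj d) (hsurj c)]
  simp

/-- The zeros of a quadratic form, counted with the help of a maximal totally singular subspace. -/
theorem card_zeros_add_le [Fintype V] [DecidableEq k] (B : QuadraticForm k V) (W : Submodule k V)
    (hW : ∀ w ∈ W, B w = 0)
    (hmax : ∀ v, B v = 0 → (∀ w ∈ W, QuadraticMap.polar B v w = 0) → v ∈ W) :
    Fintype.card k * (Finset.univ.filter fun v => B v = 0).card + Nat.card W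
      ≤ Fintype.card k * Nat.card W + Fintype.card V := by
  classical
  rw [Nat.card_eq_fintype_card]
  -- U is the complement of the orthogonal of W. It is a union of cosets of W, and all zeros outside
  -- U lie in W by maximality.
  set U : Finset V := Finset.univ.filter fun v => ∃ w ∈ W, QuadraticMap.polar B v w ≠ 0 with hU
  have hWW : ∀ w ∈ W, ∀ w' ∈ W, QuadraticMap.polar B w w' = 0 := fun w hw w' hw' => by
    simp [QuadraticMap.polar, hW _ hw, hW _ hw', hW _ (W.add_mem hw hw')]
  have hUW : ∀ v, ∀ w ∈ W, (v + w ∈ U ↔ v ∈ U) := by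
    intro v w hw
    simp only [hU, Finset.mem_filter, Finset.mem_univ, true_and]
    refine exists_congr fun w' => and_congr_right fun hw' => ?_
    rw [QuadraticMap.polar_add_left, hWW w hw w' hw', add_zero]
  have h1 : (Finset.univ.filter fun v => B v = 0).card
      ≤ Fintype.card W + (U.filter fun v => B v = 0).card := by
    have : (Finset.univ.filter fun v => B v = 0)
        ⊆ (Finset.univ.filter fun v => v ∈ W) ∪ (U.filter fun v => B v = 0) := by
      intro v hv
      simp only [hU, Finset.mem_union, Finset.mem_filter, Finset.mem_univ, true_and] at hv ⊢
      by_cases h : ∃ w ∈ W, QuadraticMap.polar B v w ≠ 0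
      · exact Or.inr ⟨h, hv⟩
      · push Not at h
        exact Or.inl (hmax v hv h)
    refine (Finset.card_le_card this).trans ((Finset.card_union_le _ _).trans ?_)
    rw [← Fintype.card_subtype]
  -- On a coset v + W inside U, B(v + w) = B(v) + polar(v, w) is a nonconstant affine function of w,
  -- so exactly one vector in q is a zero. Pairs (v, w) are counted in two ways.
  have h2 : Fintype.card k * (U.filter fun v => B v = 0).card = U.card := by
    have hdc : ∑ v ∈ U, (Finset.univ.filter fun w : W => B (v + w) = 0).card
        = ∑ w : W, (U.filter fun v => B (v + w) = 0).card :=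
      Finset.sum_card_bipartiteAbove_eq_sum_card_bipartiteBelow fun v (w : W) => B (v + w) = 0
    have e1 : ∀ v ∈ U, Fintype.card k * (Finset.univ.filter fun w : W => B (v + w) = 0).card
        = Fintype.card W := by
      intro v hv
      simp only [hU, Finset.mem_filter, Finset.mem_univ, true_and] at hv
      obtain ⟨w, hw, hne⟩ := hv
      have hf : (QuadraticMap.polarBilin B v).comp W.subtype ≠ 0 := fun h0 =>
        hne (LinearMap.congr_fun h0 ⟨w, hw⟩)
      rw [← card_mul_card_fiber hf (- B v)]
      congr 2
      ext w'
      simp only [Finset.mem_filter, Finset.mem_univ, true_and]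
      rw [QuadraticMap.map_add B, hW _ w'.2]
      simp only [LinearMap.comp_apply, Submodule.subtype_apply, QuadraticMap.polarBilin_apply_apply]
      constructor <;> intro h' <;> linear_combination h'
    have e2 : ∀ w : W, (U.filter fun v => B (v + w) = 0).card
        = (U.filter fun v => B v = 0).card := by
      intro w
      refine Finset.card_bij (fun v _ => v + w) ?_ (fun v _ v' _ h => add_right_cancel h) ?_
      · intro v hv
        rw [Finset.mem_filter] at hv ⊢
        exact ⟨(hUW v w w.2).2 hv.1, hv.2⟩
      · intro v hv
        rw [Finset.mem_filter] at hv
        refine ⟨v - w, ?_, sub_add_cancel _ _⟩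
        rw [Finset.mem_filter, ← hUW (v - w) w w.2, sub_add_cancel]
        exact hv
    have hpos : 0 < Fintype.card W := Fintype.card_pos
    rw [Finset.sum_congr rfl fun w _ => e2 w, Finset.sum_const, Finset.card_univ,
      smul_eq_mul] at hdc
    have := congrArg (Fintype.card k * ·) hdc
    simp only [Finset.mul_sum] at this
    rw [Finset.sum_congr rfl e1, Finset.sum_const, smul_eq_mul] at this
    apply Nat.eq_of_mul_eq_mul_right hpos
    rw [this]
    ring
  have h3 : U.card + Fintype.card W ≤ Fintype.card V := by
    rw [Fintype.card_subtype (· ∈ W), ← Finset.card_union_of_disjoint]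
    · exact Finset.card_le_univ _
    · rw [Finset.disjoint_filter]
      rintro v - ⟨w, hw, hne⟩ hv
      exact hne (hWW v hv w hw)
  nlinarith

/-- A quadratic form in four variables without totally singular subspaces of dimension three has
at most `q³ + q² - q` zeros. -/
theorem card_zeros_add_card_le [Fintype V] [DecidableEq k] (hV : Module.finrank k V = 4)
    (B : QuadraticForm k V)
    (hB : ∀ W : Submodule k V, (∀ w ∈ W, B w = 0) → Module.finrank k W ≤ 2) :
    (Finset.univ.filter fun v => B v = 0).card + Fintype.card k
      ≤ Fintype.card k ^ 3 + Fintype.card k ^ 2 := by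
  have : FiniteDimensional k V := .of_finrank_pos (by omega)
  obtain ⟨W, hW, hmax⟩ := exists_maximal_totallySingular B
  have h1 := card_zeros_add_le B W hW hmax
  have h2 : Nat.card W ≤ Fintype.card k ^ 2 := by
    rw [Module.natCard_eq_pow_finrank (K := k), Nat.card_eq_fintype_card]
    exact Nat.pow_le_pow_right Fintype.card_pos (hB W hW)
  have h3 : Fintype.card V = Fintype.card k ^ 4 := by
    rw [Module.card_eq_pow_finrank (K := k), hV]
  have hq : 1 < Fintype.card k := Fintype.one_lt_card
  rw [h3] at h1
  obtain ⟨r, hr⟩ : ∃ r, Fintype.card k = r + 1 := ⟨Fintype.card k - 1, by omega⟩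
  -- The bound qN ≤ (q - 1)#W + q⁴ increases with #W, so the extreme case is #W = q².
  have h4 : Fintype.card k * ((Finset.univ.filter fun v => B v = 0).card + Fintype.card k)
      ≤ Fintype.card k * (Fintype.card k ^ 3 + Fintype.card k ^ 2) := by
    rw [hr] at h1 h2 ⊢
    nlinarith [Nat.mul_le_mul_left r h2]
  exact Nat.le_of_mul_le_mul_left h4 (by omega)

end QuadraticForm

variable {k : Type*} [Field k]

theorem exists_linearMap_eq_eval {L : MvPolynomial (Fin 4) k} (hL : L.IsHomogeneous 1) :
    ∃ l : (Fin 4 → k) →ₗ[k] k, ∀ v, l v = MvPolynomial.eval v L := by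
  have hL' : L ∈ MvPolynomial.homogeneousSubmodule (Fin 4) k 1 := hL
  rw [MvPolynomial.homogeneousSubmodule_one_eq_span_X] at hL'
  induction hL' using Submodule.span_induction with
  | mem x hx =>
    obtain ⟨i, rfl⟩ := hx
    exact ⟨LinearMap.proj i, fun v => by simp⟩
  | zero => exact ⟨0, fun v => by simp⟩
  | add x y hx hy ihx ihy =>
    rw [← MvPolynomial.homogeneousSubmodule_one_eq_span_X] at hx hy
    obtain ⟨l, hl⟩ := ihx hx
    obtain ⟨m, hm⟩ := ihy hy
    exact ⟨l + m, fun v => by simp [hl, hm]⟩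
  | smul a x hx ihx =>
    rw [← MvPolynomial.homogeneousSubmodule_one_eq_span_X] at hx
    obtain ⟨l, hl⟩ := ihx hx
    exact ⟨a • l, fun v => by simp [hl, MvPolynomial.smul_eval]⟩

/-- Forms of degree 2 are sums of products of linear forms, so no division by 2 is needed. -/
theorem exists_quadraticForm_eq_eval {F : MvPolynomial (Fin 4) k} (hF : F.IsHomogeneous 2) :
    ∃ B : QuadraticForm k (Fin 4 → k), ∀ v, B v = MvPolynomial.eval v F := by
  have hF' : F ∈ MvPolynomial.homogeneousSubmodule (Fin 4) k 2 := hF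
  rw [← MvPolynomial.homogeneousSubmodule_one_pow, pow_two] at hF'
  clear hF
  induction hF' using Submodule.mul_induction_on' with
  | mem_mul_mem x hx y hy =>
    obtain ⟨l, hl⟩ := exists_linearMap_eq_eval hx
    obtain ⟨m, hm⟩ := exists_linearMap_eq_eval hy
    exact ⟨QuadraticMap.linMulLin l m, fun v => by simp [hl, hm]⟩
  | add x _ y _ ihx ihy =>
    obtain ⟨l, hl⟩ := ihx
    obtain ⟨m, hm⟩ := ihy
    exact ⟨l + m, fun v => by simp [hl, hm]⟩

/-- A form of degree at most `#k` that vanishes at all `k`-points of a hyperplane is divisible by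
the equation of the hyperplane. -/
theorem exists_linear_dvd_of_vanish [Fintype k] {F : MvPolynomial (Fin 4) k} {n : ℕ}
    (hF : F.IsHomogeneous n) (hn : n ≤ Fintype.card k) {l : (Fin 4 → k) →ₗ[k] k} (hl : l ≠ 0)
    (h : ∀ v, l v = 0 → MvPolynomial.eval v F = 0) :
    ∃ L : MvPolynomial (Fin 4) k, L ≠ 0 ∧ L.IsHomogeneous 1 ∧ L ∣ F := by
  classical
  set a : Fin 4 → k := fun i => l (Pi.single i 1) with ha
  have hla : ∀ v, l v = ∑ i, a i * v i := by
    intro v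
    conv_lhs => rw [← Finset.univ_sum_single v]
    rw [map_sum]
    refine Finset.sum_congr rfl fun i _ => ?_
    rw [ha, ← smul_eq_mul, smul_eq_mul, mul_comm, ← smul_eq_mul, ← map_smul]
    congr 1
    rw [← Pi.single_smul, smul_eq_mul, mul_one]
  obtain ⟨j, hj⟩ : ∃ j, a j ≠ 0 := by
    by_contra hcon
    push Not at hcon
    exact hl (LinearMap.ext fun v => by simp [hla, hcon])
  set L : MvPolynomial (Fin 4) k := ∑ i, MvPolynomial.C (a i) * MvPolynomial.X i with hLdef
  have hLe : ∀ v, MvPolynomial.eval v L = l v := fun v => by simp [hLdef, hla]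
  have hL1 : L.IsHomogeneous 1 := by
    refine MvPolynomial.IsHomogeneous.sum _ _ _ fun i _ => ?_
    exact (MvPolynomial.isHomogeneous_X k i).C_mul _
  refine ⟨L, ?_, hL1, ?_⟩
  · intro h0
    apply hj
    have := hLe (Pi.single j 1)
    rw [h0, map_zero] at this
    exact this.symm
  -- The projection onto the hyperplane along the j-th axis; the factor 1/aⱼ makes L vanish on its
  -- image.
  set e : Fin 4 → MvPolynomial (Fin 4) k := fun i =>
    MvPolynomial.X i - MvPolynomial.C ((Pi.single j (a j)⁻¹ : Fin 4 → k) i) * L with he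
  have he1 : ∀ i, (e i).IsHomogeneous 1 := fun i =>
    (MvPolynomial.isHomogeneous_X k i).sub (hL1.C_mul _)
  have hF0 : MvPolynomial.aeval e F = 0 := by
    have hFn : (MvPolynomial.aeval e F).IsHomogeneous n := by
      have := hF.aeval e he1
      rwa [one_mul] at this
    -- A form of degree at most q vanishing at all k-points is zero.
    refine hFn.eq_zero_of_forall_eval_eq_zero_of_le_card (fun v => ?_) (by simpa using hn)
    rw [← MvPolynomial.aeval_eq_eval, ← AlgHom.comp_apply,
      MvPolynomial.comp_aeval, MvPolynomial.aeval_eq_eval]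
    apply h
    have : (fun i => (MvPolynomial.aeval v) (e i)) = v - l v • Pi.single j (a j)⁻¹ := by
      funext i
      simp [he, MvPolynomial.aeval_eq_eval, hLe, mul_comm]
    rw [this, map_sub, map_smul, hla (Pi.single j (a j)⁻¹)]
    simp [Pi.single_apply, hj]
  rw [← Ideal.mem_span_singleton, ← Ideal.Quotient.eq_zero_iff_mem]
  -- The projection is the identity modulo L, so F ≡ F(e) = 0.
  have hcomp : (Ideal.Quotient.mkₐ k (Ideal.span {L})).comp (MvPolynomial.aeval e)
      = Ideal.Quotient.mkₐ k (Ideal.span {L}) := by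
    ext i
    simp only [AlgHom.comp_apply, MvPolynomial.aeval_X, he, Ideal.Quotient.mkₐ_eq_mk]
    rw [Ideal.Quotient.eq, Ideal.mem_span_singleton]
    exact ⟨- MvPolynomial.C ((Pi.single j (a j)⁻¹ : Fin 4 → k) i), by ring⟩
  have := DFunLike.congr_fun hcomp F
  rw [AlgHom.comp_apply, hF0, map_zero] at this
  exact this.symm

theorem coeff_eq_zero_of_mem_span {Q Y : MvPolynomial (Fin 4) k} {d : ℕ} (hQ : Q.IsHomogeneous d)
    (hY : Y.IsHomogeneous d) {P : MvPolynomial (Fin 4) k} (hP : P ∈ Ideal.span {Q, Y})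
    {e : Fin 4 →₀ ℕ} (he : e.degree < d) : P.coeff e = 0 := by
  classical
  have key : ∀ A B : MvPolynomial (Fin 4) k, B.IsHomogeneous d → (A * B).coeff e = 0 := by
    intro A B hB
    rw [MvPolynomial.coeff_mul]
    refine Finset.sum_eq_zero fun x hx => ?_
    rw [Finset.HasAntidiagonal.mem_antidiagonal] at hx
    rw [hB.coeff_eq_zero, mul_zero]
    have : e.degree = x.1.degree + x.2.degree := by rw [← hx, map_add]
    omega
  obtain ⟨A, B, rfl⟩ := Ideal.mem_span_pair.1 hP
  rw [MvPolynomial.coeff_add, key _ _ hQ, key _ _ hY, add_zero]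

/-- A prime ideal generated by two quadratic forms contains no quadratic form divisible by a
linear form. -/
theorem not_linear_dvd_of_mem_span {Q Y : MvPolynomial (Fin 4) k} (hQ : Q.IsHomogeneous 2)
    (hY : Y.IsHomogeneous 2) (hP : (Ideal.span {Q, Y}).IsPrime) {F L : MvPolynomial (Fin 4) k}
    (hF : F.IsHomogeneous 2) (hF0 : F ≠ 0) (hFP : F ∈ Ideal.span {Q, Y})
    (hL : L.IsHomogeneous 1) : ¬ L ∣ F := by
  rintro ⟨M, rfl⟩
  have hL0 := left_ne_zero_of_mul hF0
  have hM0 := right_ne_zero_of_mul hF0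
  have hdeg := MvPolynomial.totalDegree_mul_of_isDomain hL0 hM0
  rw [hF.totalDegree hF0, hL.totalDegree hL0] at hdeg
  -- All terms of an element of (Q, Y) have degree at least 2. By primality one of the linear
  -- factors L, M would lie in this ideal.
  have key : ∀ G : MvPolynomial (Fin 4) k, G.totalDegree ≤ 1 → G ∈ Ideal.span {Q, Y} → G = 0 := by
    intro G hG hGP
    ext e
    by_cases he : e.degree < 2
    · rw [coeff_eq_zero_of_mem_span hQ hY hGP he, MvPolynomial.coeff_zero]
    · rw [MvPolynomial.coeff_zero, MvPolynomial.coeff_eq_zero_of_totalDegree_lt]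
      rw [← Finsupp.degree_apply]
      omega
  rcases hP.mem_or_mem hFP with h | h
  · exact hL0 (key L (hL.totalDegree_le) h)
  · exact hM0 (key M (by omega) h)

theorem exists_ker_le_of_three_le_finrank {W : Submodule k (Fin 4 → k)}
    (hW : 3 ≤ Module.finrank k W) : ∃ l : (Fin 4 → k) →ₗ[k] k, l ≠ 0 ∧ LinearMap.ker l ≤ W := by
  by_cases hT : W = ⊤
  · refine ⟨LinearMap.proj 0, fun h => ?_, hT ▸ le_top⟩
    have := LinearMap.congr_fun h (fun _ => (1 : k))
    simp at this
  · obtain ⟨l, hl, hle⟩ := Submodule.exists_le_ker_of_lt_top W (lt_top_iff_ne_top.2 hT)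
    refine ⟨l, hl, le_of_eq (Submodule.eq_of_le_of_finrank_le hle ?_).symm⟩
    have h1 := l.finrank_range_add_finrank_ker
    rw [LinearMap.range_eq_top.2 (LinearMap.surjective hl), finrank_top, Module.finrank_self,
      Module.finrank_fin_fun] at h1
    omega

/-- The common zeros of two quadratic forms that generate a prime ideal, counted by means of the
pencil of quadrics spanned by them. -/
theorem card_mul_card_common_zeros_add_le [Fintype k] [DecidableEq k]
    {Q Y : MvPolynomial (Fin 4) k}
    (hQ : Q.IsHomogeneous 2) (hY : Y.IsHomogeneous 2) (hP : (Ideal.span {Q, Y}).IsPrime)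
    (hQY : ¬ Q ∣ Y) :
    Fintype.card k * (Finset.univ.filter fun v : Fin 4 → k =>
        MvPolynomial.eval v Q = 0 ∧ MvPolynomial.eval v Y = 0).card + Fintype.card k ^ 2
      ≤ Fintype.card k ^ 3 +
        (Finset.univ.filter fun v : Fin 4 → k => MvPolynomial.eval v Q = 0).card := by
  have hq : 2 ≤ Fintype.card k := Fintype.one_lt_card
  -- A three-dimensional totally singular subspace would force a linear factor of Y + cQ; here the
  -- degree bound is 2 ≤ q.
  have hmem : ∀ c : k, (Finset.univ.filter fun v : Fin 4 → k =>
      MvPolynomial.eval v Y + c * MvPolynomial.eval v Q = 0).card + Fintype.card k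
        ≤ Fintype.card k ^ 3 + Fintype.card k ^ 2 := by
    intro c
    set F := Y + MvPolynomial.C c * Q with hFdef
    have hF : F.IsHomogeneous 2 := hY.add (hQ.C_mul c)
    have hF0 : F ≠ 0 := by
      intro h0
      exact hQY ⟨- MvPolynomial.C c, by linear_combination hFdef.symm.trans h0⟩
    have hFP : F ∈ Ideal.span {Q, Y} :=
      Ideal.add_mem _ (Ideal.subset_span (by simp))
        (Ideal.mul_mem_left _ _ (Ideal.subset_span (by simp)))
    obtain ⟨B, hB⟩ := exists_quadraticForm_eq_eval hF
    have := card_zeros_add_card_le (by rw [Module.finrank_fin_fun]) B fun W hW => by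
      by_contra hcon
      obtain ⟨l, hl, hle⟩ := exists_ker_le_of_three_le_finrank (W := W) (by omega)
      obtain ⟨L, hL0, hL1, hLF⟩ := exists_linear_dvd_of_vanish hF hq hl fun v hv => by
        rw [← hB]
        exact hW v (hle hv)
      exact not_linear_dvd_of_mem_span hQ hY hP hF hF0 hFP hL1 hLF
    simpa [hB, hFdef] using this
  have hsum := Finset.sum_le_sum fun c (_ : c ∈ (Finset.univ : Finset k)) => hmem c
  rw [Finset.sum_add_distrib, Finset.sum_const, Finset.sum_const, Finset.card_univ, smul_eq_mul,
    smul_eq_mul] at hsum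
  have hdc : ∑ c : k, (Finset.univ.filter fun v : Fin 4 → k =>
      MvPolynomial.eval v Y + c * MvPolynomial.eval v Q = 0).card
      = ∑ v : Fin 4 → k, (Finset.univ.filter fun c : k =>
        MvPolynomial.eval v Y + c * MvPolynomial.eval v Q = 0).card :=
    Finset.sum_card_bipartiteAbove_eq_sum_card_bipartiteBelow _
  -- A base vector lies on all q members, a vector off Q = 0 on exactly one, and any other vector on
  -- none.
  have hcount : ∀ v : Fin 4 → k, (Finset.univ.filter fun c : k =>
      MvPolynomial.eval v Y + c * MvPolynomial.eval v Q = 0).card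
      = Fintype.card k *
          (if MvPolynomial.eval v Q = 0 ∧ MvPolynomial.eval v Y = 0 then 1 else 0)
        + (if ¬ MvPolynomial.eval v Q = 0 then 1 else 0) := by
    intro v
    by_cases hQv : MvPolynomial.eval v Q = 0
    · by_cases hYv : MvPolynomial.eval v Y = 0
      · simp [hQv, hYv]
      · simp [hQv, hYv]
    · simp only [hQv, false_and, if_false, not_false_eq_true, if_true, mul_zero, zero_add]
      rw [Finset.card_eq_one]
      refine ⟨- MvPolynomial.eval v Y / MvPolynomial.eval v Q, ?_⟩
      ext c
      simp only [Finset.mem_filter, Finset.mem_univ, true_and, Finset.mem_singleton]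
      rw [eq_div_iff hQv]
      constructor <;> intro h' <;> linear_combination h'
  rw [hdc, Finset.sum_congr rfl fun v _ => hcount v, Finset.sum_add_distrib, ← Finset.mul_sum,
    ← Finset.card_filter, ← Finset.card_filter] at hsum
  have htot := Finset.card_filter_add_card_filter_not (s := (Finset.univ : Finset (Fin 4 → k)))
    (fun v => MvPolynomial.eval v Q = 0)
  rw [Finset.card_univ, Fintype.card_fun, Fintype.card_fin] at htot
  nlinarith

end Pencil

/-! ### The case s < q: the affine chart and conjugate coordinates -/

section Chart

variable {k : Type*} [Field k]

theorem not_isUnit_of_isHomogeneous {F : MvPolynomial (Fin 4) k} {n : ℕ} (hn : n ≠ 0)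
    (hF : F.IsHomogeneous n) : ¬ IsUnit F := by
  intro h
  have h1 := h.map (MvPolynomial.eval (0 : Fin 4 → k))
  have h2 := aeval_mul_of_isHomogeneous hF (0 : Fin 4 → k) (0 : k)
  simp only [Pi.zero_apply, mul_zero, zero_pow hn, zero_mul] at h2
  exact h1.ne_zero h2

/-- An irreducible binary quadratic form is anisotropic. -/
theorem eq_zero_of_binaryEval_eq_zero {a b c : k} (hf : Irreducible (binaryForm a b c)) {x y : k}
    (h : binaryEval a b c x y = 0) : x = 0 ∧ y = 0 := by
  have hX := fun i : Fin 4 => MvPolynomial.isHomogeneous_X k i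
  simp only [binaryEval, Algebra.algebraMap_self, RingHom.id_apply] at h
  by_cases hy : y = 0
  · by_cases hx : x = 0
    · exact ⟨hx, hy⟩
    have ha : a = 0 := by
      rw [hy] at h
      simpa [hx] using h
    have hfac : binaryForm a b c = MvPolynomial.X 1 *
        (MvPolynomial.C b * MvPolynomial.X 0 + MvPolynomial.C c * MvPolynomial.X 1) := by
      rw [binaryForm, ha, map_zero]; ring
    rcases hf.isUnit_or_isUnit hfac with h' | h'
    · exact absurd h' (not_isUnit_of_isHomogeneous one_ne_zero (hX 1))
    · exact absurd h' (not_isUnit_of_isHomogeneous one_ne_zero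
        (((hX 0).C_mul b).add ((hX 1).C_mul c)))
  -- The root x/y splits off a linear factor of f.
  · have hc : c = - (a * (x / y) ^ 2 + b * (x / y)) := by
      field_simp
      linear_combination h
    have hfac : binaryForm a b c
        = (MvPolynomial.X 0 - MvPolynomial.C (x / y) * MvPolynomial.X 1) *
        (MvPolynomial.C a * MvPolynomial.X 0
          + MvPolynomial.C (b + a * (x / y)) * MvPolynomial.X 1) := by
      rw [binaryForm, hc]
      simp only [map_neg, map_add, map_mul, map_pow]
      ring
    rcases hf.isUnit_or_isUnit hfac with h' | h'
    · exact absurd h' (not_isUnit_of_isHomogeneous one_ne_zero ((hX 0).sub ((hX 1).C_mul _)))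
    · exact absurd h' (not_isUnit_of_isHomogeneous one_ne_zero
        (((hX 0).C_mul a).add ((hX 1).C_mul _)))

theorem eval_normalForm (a b c : k) (v : Fin 4 → k) :
    MvPolynomial.eval v (normalForm a b c) = binaryEval a b c (v 0) (v 1) + v 2 * v 3 := by
  rw [← MvPolynomial.aeval_eq_eval, map_add, aeval_binaryForm, map_mul, MvPolynomial.aeval_X,
    MvPolynomial.aeval_X]

/-- The parametrization of the affine part `x₂ = 1` of the quadric in normal form. -/
def chart {A : Type*} [CommRing A] [Algebra k A] (a b c : k) (x y : A) : Fin 4 → A :=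
  ![x, y, 1, - binaryEval a b c x y]

/-- The zeros of `Y` on the quadric in normal form, counted by means of its affine part. -/
theorem card_zeros_le_card_chart [Fintype k] [DecidableEq k] {a b c : k}
    (hf : Irreducible (binaryForm a b c)) {Y : MvPolynomial (Fin 4) k} {s : ℕ}
    (hY : Y.IsHomogeneous s) :
    (Finset.univ.filter fun v : Fin 4 → k =>
      MvPolynomial.eval v (normalForm a b c) = 0 ∧ MvPolynomial.eval v Y = 0).card
    ≤ (Fintype.card k - 1) * (Finset.univ.filter fun z : k × k =>
      MvPolynomial.eval (chart a b c z.1 z.2) Y = 0).card + Fintype.card k := by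
  classical
  set Z := Finset.univ.filter fun v : Fin 4 → k =>
      MvPolynomial.eval v (normalForm a b c) = 0 ∧ MvPolynomial.eval v Y = 0 with hZ
  have hq : (Finset.univ.filter fun r : k => r ≠ 0).card = Fintype.card k - 1 := by
    rw [Finset.filter_ne', Finset.card_erase_of_mem (Finset.mem_univ _), Finset.card_univ]
  rw [← Finset.card_filter_add_card_filter_not (s := Z) (fun v => v 2 ≠ 0)]
  refine Nat.add_le_add ?_ ?_
  · rw [← hq, ← Finset.card_product]
    refine Finset.card_le_card_of_injOn (fun v => (v 2, (v 0 / v 2, v 1 / v 2))) ?_ ?_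
    · intro v hv
      simp only [hZ, Finset.coe_filter, Finset.mem_filter, Finset.mem_univ, true_and,
        Set.mem_ofPred_eq, eval_normalForm] at hv
      obtain ⟨⟨hQ, hYv⟩, h2⟩ := hv
      simp only [Finset.coe_product, Set.mem_prod, Finset.coe_filter, Finset.mem_univ, true_and,
        Set.mem_ofPred_eq]
      refine ⟨h2, ?_⟩
      have hv' : v = fun i => v 2 * chart a b c (v 0 / v 2) (v 1 / v 2) i := by
        funext i
        fin_cases i
        · simp [chart]; field_simp
        · simp [chart]; field_simp
        · simp [chart]
        · simp only [chart, binaryEval, Algebra.algebraMap_self, RingHom.id_apply] at hQ ⊢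
          simp
          field_simp
          linear_combination hQ
      rw [hv', ← MvPolynomial.aeval_eq_eval, aeval_mul_of_isHomogeneous hY] at hYv
      exact (mul_eq_zero.1 hYv).resolve_left (pow_ne_zero s h2)
    · intro v hv w hw h
      simp only [hZ, Finset.coe_filter, Finset.mem_filter, Finset.mem_univ, true_and,
        Set.mem_ofPred_eq, eval_normalForm] at hv hw
      obtain ⟨⟨hQ, -⟩, h2⟩ := hv
      obtain ⟨⟨hQ', -⟩, h2'⟩ := hw
      simp only [Prod.mk.injEq] at h
      obtain ⟨e2, e0, e1⟩ := h
      rw [e2] at e0 e1 hQ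
      have f0 : v 0 = w 0 := by
        rwa [div_left_inj' h2'] at e0
      have f1 : v 1 = w 1 := by
        rwa [div_left_inj' h2'] at e1
      have f3 : v 3 = w 3 := by
        rw [f0, f1] at hQ
        apply mul_left_cancel₀ h2'
        linear_combination hQ - hQ'
      funext i
      fin_cases i <;> assumption
  -- If x₂ = 0 then anisotropy forces x₀ = x₁ = 0. Only the line of (0, 0, 0, 1), with q vectors, is
  -- left.
  · rw [← Finset.card_univ (α := k)]
    refine Finset.card_le_card_of_injOn (fun v => v 3) (fun _ _ => Finset.mem_univ _) ?_
    have key : ∀ v : Fin 4 → k, v ∈ Z.filter (fun v => ¬ v 2 ≠ 0) →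
        v 0 = 0 ∧ v 1 = 0 ∧ v 2 = 0 := by
      intro v hv
      simp only [hZ, Finset.mem_filter, Finset.mem_univ, true_and, eval_normalForm,
        not_not] at hv
      obtain ⟨⟨hQ, -⟩, h2⟩ := hv
      rw [h2, zero_mul, add_zero] at hQ
      exact ⟨(eq_zero_of_binaryEval_eq_zero hf hQ).1, (eq_zero_of_binaryEval_eq_zero hf hQ).2, h2⟩
    intro v hv w hw h
    obtain ⟨v0, v1, v2⟩ := key v hv
    obtain ⟨w0, w1, w2⟩ := key w hw
    funext i
    fin_cases i
    · exact v0.trans w0.symm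
    · exact v1.trans w1.symm
    · exact v2.trans w2.symm
    · exact h

open Polynomial in
/-- A polynomial in `U` and `V` of degree less than `q` in `U` does not vanish on `V = U ^ q`. -/
theorem eval₂_expand_ne_zero {K : Type*} [Field K] {q : ℕ} {p : Polynomial (Polynomial K)}
    (hp : p ≠ 0) (hq : p.natDegree < q) :
    p.eval₂ (Polynomial.expand K q : K[X] →+* K[X]) Polynomial.X ≠ 0 := by
  intro h
  apply hp
  ext i j
  rw [Polynomial.coeff_zero, Polynomial.coeff_zero]
  by_cases hi : i < q
  swap
  · rw [Polynomial.coeff_eq_zero_of_natDegree_lt (p := p) (by omega), Polynomial.coeff_zero]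
  -- As i < q, division by q recovers (i, j) from jq + i. So distinct monomials UⁱVʲ go to distinct
  -- powers of U.
  have h1 := congrArg (fun r => Polynomial.coeff r (j * q + i)) h
  rw [Polynomial.eval₂_eq_sum_range' _ hq] at h1
  simp only [Polynomial.finsetSum_coeff, Polynomial.coeff_zero, RingHom.coe_coe,
    Polynomial.coeff_mul_X_pow', Polynomial.coeff_expand (by omega : 0 < q)] at h1
  rw [Finset.sum_eq_single_of_mem i (Finset.mem_range.2 hi)] at h1
  · rw [if_pos (by omega), Nat.add_sub_cancel, if_pos (Dvd.intro_left j rfl),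
      Nat.mul_div_cancel _ (by omega)] at h1
    exact h1
  · intro l hl hli
    rw [Finset.mem_range] at hl
    split_ifs with h2 h3
    · exfalso
      have h4 : (l : ℤ) ≡ i [ZMOD q] := by
        have : (q : ℤ) ∣ ((j * q + i - l : ℕ) : ℤ) := by exact_mod_cast h3
        rw [Nat.cast_sub h2] at this
        have h5 : (q : ℤ) ∣ i - l := by
          have h6 : (i - l : ℤ) = ((j * q + i : ℕ) : ℤ) - l - j * q := by push_cast; ring
          rw [h6]
          exact dvd_sub this (dvd_mul_left _ _)
        exact (Int.modEq_iff_dvd).2 h5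
      rw [Int.natCast_modEq_iff, Nat.ModEq, Nat.mod_eq_of_lt hl, Nat.mod_eq_of_lt hi] at h4
      exact hli h4
    · rfl
    · rfl

/-- The q elements of k already exhaust the roots of X^q - X. -/
theorem exists_algebraMap_eq_of_pow_card_eq [Fintype k] {K : Type*} [Field K] [Algebra k K] {x : K}
    (hx : x ^ Fintype.card k = x) : ∃ r, algebraMap k K r = x := by
  classical
  by_contra hcon
  push Not at hcon
  have hq : 1 < Fintype.card k := Fintype.one_lt_card
  have hp0 : (Polynomial.X ^ Fintype.card k - Polynomial.X : Polynomial K) ≠ 0 :=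
    FiniteField.X_pow_card_sub_X_ne_zero K hq
  have hinj := (algebraMap k K).injective
  have hsub : insert x (Finset.univ.image (algebraMap k K))
      ⊆ (Polynomial.X ^ Fintype.card k - Polynomial.X : Polynomial K).roots.toFinset := by
    intro y hy
    rw [Multiset.mem_toFinset, Polynomial.mem_roots hp0, Polynomial.IsRoot.def]
    rw [Finset.mem_insert, Finset.mem_image] at hy
    rcases hy with rfl | ⟨r, -, rfl⟩
    · simp [hx]
    · simp [← map_pow, FiniteField.pow_card]
  have h1 := (Finset.card_le_card hsub).trans
    ((Multiset.toFinset_card_le _).trans (Polynomial.card_roots' _))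
  rw [FiniteField.X_pow_card_sub_X_natDegree_eq K hq, Finset.card_insert_of_notMem,
    Finset.card_image_of_injective _ hinj, Finset.card_univ] at h1
  · omega
  · rw [Finset.mem_image]
    rintro ⟨r, -, hr⟩
    exact hcon r hr

/-- Over an extension of the finite field `k`, an irreducible binary quadratic form is a multiple
of a norm form. -/
theorem exists_conjugate_roots [Fintype k] {a b c : k} (hf : Irreducible (binaryForm a b c)) :
    ∃ α : AlgebraicClosure k, α ^ Fintype.card k ≠ α ∧
      (∀ r, algebraMap k (AlgebraicClosure k) r ≠ α) ∧
      algebraMap k _ b = - algebraMap k _ a * (α + α ^ Fintype.card k) ∧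
      algebraMap k _ c = algebraMap k _ a * (α * α ^ Fintype.card k) := by
  have ha : a ≠ 0 := by
    rintro rfl
    exact one_ne_zero (eq_zero_of_binaryEval_eq_zero hf (x := 1) (y := 0) (by simp [binaryEval])).1
  set i := algebraMap k (AlgebraicClosure k) with hi
  have hia : i a ≠ 0 := by rwa [Ne, map_eq_zero]
  obtain ⟨α, hα⟩ := IsAlgClosed.exists_root
    (Polynomial.C (i a) * Polynomial.X ^ 2 + Polynomial.C (i b) * Polynomial.X + Polynomial.C (i c))
    (by rw [Polynomial.degree_quadratic hia]; decide)
  simp only [Polynomial.IsRoot.def, Polynomial.eval_add, Polynomial.eval_mul, Polynomial.eval_C,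
    Polynomial.eval_pow, Polynomial.eval_X] at hα
  have hαk : ∀ r, i r ≠ α := by
    rintro r rfl
    have h0 : binaryEval a b c r 1 = 0 := by
      apply i.injective
      simp only [binaryEval, Algebra.algebraMap_self, RingHom.id_apply, map_add, map_mul, map_pow,
        map_one, map_zero]
      linear_combination hα
    exact one_ne_zero (eq_zero_of_binaryEval_eq_zero hf h0).2
  have hαq : α ^ Fintype.card k ≠ α := fun h => by
    obtain ⟨r, hr⟩ := exists_algebraMap_eq_of_pow_card_eq h
    exact hαk r hr
  -- Frobenius sends the root α to the second root α^q; Vieta's formulas follow.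
  have hα' : i a * (α ^ Fintype.card k) ^ 2 + i b * α ^ Fintype.card k + i c = 0 := by
    have h1 := congrArg (FiniteField.frobeniusAlgHom k (AlgebraicClosure k)) hα
    simp only [map_add, map_mul, map_pow, hi, AlgHom.commutes, map_zero,
      FiniteField.coe_frobeniusAlgHom] at h1
    exact h1
  have hb : i b = - i a * (α + α ^ Fintype.card k) := by
    apply mul_left_cancel₀ (sub_ne_zero.2 hαq)
    linear_combination hα' - hα
  exact ⟨α, hαq, hαk, hb, by linear_combination hα - α * hb⟩

theorem snoc_eq_mul_chart {L : Type*} [Field L] [Algebra k L] (a b c : k) {t : Fin 3 → L}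
    (ht2 : t 2 ≠ 0) : (Fin.snoc t (- binaryEval a b c (t 0) (t 1) / t 2) : Fin 4 → L)
      = fun i => t 2 * chart a b c (t 0 / t 2) (t 1 / t 2) i := by
  funext i
  refine Fin.lastCases ?_ (fun j => ?_) i
  · rw [Fin.snoc_last]
    change _ = t 2 * - binaryEval a b c (t 0 / t 2) (t 1 / t 2)
    simp only [binaryEval]
    field_simp
  · rw [Fin.snoc_castSucc (α := fun _ => L)]
    fin_cases j
    · exact (mul_div_cancel₀ (t 0) ht2).symm
    · exact (mul_div_cancel₀ (t 1) ht2).symm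
    · exact (mul_one _).symm

section Conjugate

variable {K : Type*} [Field K] [Algebra k K]

/-- The chart in the conjugate coordinates `u = x - α y` and `v = x - β y`. -/
def conjChart {A : Type*} [CommRing A] [Algebra k A] [Algebra K A] (a b c : k) (α β : K)
    (u v : A) : Fin 4 → A :=
  chart a b c (u + algebraMap K A α * (algebraMap K A (α - β)⁻¹ * (v - u)))
    (algebraMap K A (α - β)⁻¹ * (v - u))

variable {A : Type*} [CommRing A] [Algebra k A] [Algebra K A] [IsScalarTower k K A]

theorem binaryEval_eq_mul {a b c : k} {α β : K}
    (hb : algebraMap k K b = - algebraMap k K a * (α + β))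
    (hc : algebraMap k K c = algebraMap k K a * (α * β)) (x y : A) :
    binaryEval a b c x y = algebraMap k A a *
      ((x - algebraMap K A α * y) * (x - algebraMap K A β * y)) := by
  rw [binaryEval, IsScalarTower.algebraMap_apply k K A, IsScalarTower.algebraMap_apply k K A,
    IsScalarTower.algebraMap_apply k K A, hb, hc]
  simp only [map_mul, map_neg, map_add]
  ring

theorem conjChart_eq_chart {K A : Type*} [Field K] [CommRing A] [Algebra k A] [Algebra K A]
    {a b c : k} {α β : K} (hδ : α - β ≠ 0) (x y : A) :
    conjChart a b c α β (x - algebraMap K A α * y) (x - algebraMap K A β * y)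
      = chart a b c x y := by
  have hy : algebraMap K A (α - β)⁻¹ *
      ((x - algebraMap K A β * y) - (x - algebraMap K A α * y)) = y := by
    have h1 : algebraMap K A (α - β)⁻¹ * algebraMap K A (α - β) = 1 := by
      rw [← map_mul, inv_mul_cancel₀ hδ, map_one]
    rw [map_sub] at h1
    linear_combination y * h1
  rw [conjChart, hy, sub_add_cancel]

/-- In conjugate coordinates f is auv, so every chart coordinate has degree at most one in u and in
v separately. -/
theorem conjChart_three {a b c : k} {α β : K} (hδ : α - β ≠ 0)
    (hb : algebraMap k K b = - algebraMap k K a * (α + β))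
    (hc : algebraMap k K c = algebraMap k K a * (α * β)) (u v : A) :
    conjChart a b c α β u v 3 = - (algebraMap k A a * (u * v)) := by
  have h1 : algebraMap K A (α - β)⁻¹ * algebraMap K A (α - β) = 1 := by
    rw [← map_mul, inv_mul_cancel₀ hδ, map_one]
  rw [map_sub] at h1
  have h3 : ∀ x y : A, chart a b c x y 3 = - binaryEval a b c x y := fun _ _ => rfl
  rw [conjChart, h3, binaryEval_eq_mul hb hc]
  have e1 : u + algebraMap K A α * (algebraMap K A (α - β)⁻¹ * (v - u))
      - algebraMap K A β * (algebraMap K A (α - β)⁻¹ * (v - u)) = v := by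
    linear_combination (v - u) * h1
  rw [e1, add_sub_cancel_right]

theorem map_conjChart {B : Type*} [CommRing B] [Algebra k B] [Algebra K B] [IsScalarTower k K B]
    (g : A →ₐ[K] B) (a b c : k) (α β : K) (u v : A) (i : Fin 4) :
    g (conjChart a b c α β u v i) = conjChart a b c α β (g u) (g v) i := by
  have hk : ∀ r : k, g (algebraMap k A r) = algebraMap k B r := fun r => by
    rw [IsScalarTower.algebraMap_apply k K A, AlgHom.commutes,
      ← IsScalarTower.algebraMap_apply k K B]
  fin_cases i <;> simp [conjChart, chart, binaryEval, hk]

theorem map_aeval_conjChart {B : Type*} [CommRing B] [Algebra k B] [Algebra K B]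
    [IsScalarTower k K B] (g : A →ₐ[K] B) (a b c : k) (α β : K) (u v : A)
    (Y : MvPolynomial (Fin 4) k) :
    g (MvPolynomial.aeval (conjChart a b c α β u v) Y)
      = MvPolynomial.aeval (conjChart a b c α β (g u) (g v)) Y := by
  have := DFunLike.congr_fun (MvPolynomial.comp_aeval (conjChart a b c α β u v)
    (g.restrictScalars k)) Y
  simp only [AlgHom.comp_apply, AlgHom.restrictScalars_apply, map_conjChart] at this
  exact this

open Polynomial in
-- Needed twice: with n = 1 for the degree in u over K[v], and with n = q + 1 after the substitution
-- v = u^q.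
theorem natDegree_conjChart_le {R : Type*} [CommRing R] [Algebra k R] [Algebra K R]
    [IsScalarTower k K R] {a b c : k} {α β : K} (hδ : α - β ≠ 0)
    (hb : algebraMap k K b = - algebraMap k K a * (α + β))
    (hc : algebraMap k K c = algebraMap k K a * (α * β)) {u v : R[X]} {n : ℕ}
    (hu : u.natDegree ≤ n) (hv : v.natDegree ≤ n) (huv : (u * v).natDegree ≤ n) (i : Fin 4) :
    (conjChart a b c α β u v i).natDegree ≤ n := by
  have hC : ∀ (r : K) (p : R[X]), p.natDegree ≤ n → (algebraMap K R[X] r * p).natDegree ≤ n := by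
    intro r p hp
    rw [Polynomial.algebraMap_apply]
    exact (Polynomial.natDegree_C_mul_le _ _).trans hp
  have h1 : (algebraMap K R[X] (α - β)⁻¹ * (v - u)).natDegree ≤ n :=
    hC _ _ ((Polynomial.natDegree_sub_le _ _).trans (max_le hv hu))
  fin_cases i
  · exact (Polynomial.natDegree_add_le _ _).trans (max_le hu (hC _ _ h1))
  · exact h1
  · exact (Polynomial.natDegree_one (R := R)).le.trans (Nat.zero_le _)
  · change (conjChart a b c α β u v 3).natDegree ≤ n
    rw [conjChart_three hδ hb hc, Polynomial.natDegree_neg, IsScalarTower.algebraMap_apply k K R[X]]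
    exact hC _ _ huv

open Polynomial in
-- The chart is dominant: if Y vanished on it identically, then Y would vanish at the generic point
-- t₂ · chart(t₀/t₂, t₁/t₂) of the cone, and Q would divide Y.
theorem aeval_conjChart_ne_zero {a b c : k} (hf : Irreducible (binaryForm a b c)) {α β : K}
    (hδ : α - β ≠ 0) {Y : MvPolynomial (Fin 4) k} {s : ℕ} (hY : Y.IsHomogeneous s)
    (hQY : ¬ normalForm a b c ∣ Y) :
    MvPolynomial.aeval (conjChart a b c α β (X : K[X][X]) (C X)) Y ≠ 0 := by
  intro h0
  let L := FractionRing (MvPolynomial (Fin 3) K)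
  let t : Fin 3 → L := fun j => algebraMap (MvPolynomial (Fin 3) K) L (MvPolynomial.X j)
  have ht : AlgebraicIndependent K t :=
    (MvPolynomial.algebraicIndependent_X _ _).map' (f := IsScalarTower.toAlgHom K
      (MvPolynomial (Fin 3) K) L) (FaithfulSMul.algebraMap_injective (MvPolynomial (Fin 3) K) L)
  have ht2 : t 2 ≠ 0 := ht.ne_zero 2
  let x := t 0 / t 2
  let y := t 1 / t 2
  let g : K[X][X] →ₐ[K] L := Polynomial.eval₂AlgHom
    (Polynomial.aeval (x - algebraMap K L β * y)) (x - algebraMap K L α * y)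
    (fun _ => Commute.all _ _)
  have h1 := map_aeval_conjChart g a b c α β X (C X) Y
  have hgX : g X = x - algebraMap K L α * y := by simp [g]
  have hgC : g (C X) = x - algebraMap K L β * y := by simp [g]
  rw [h0, map_zero, hgX, hgC, conjChart_eq_chart hδ] at h1
  refine hQY (normalForm_dvd_of_aeval_eq_zero hf
    (ht.restrictScalars (algebraMap k K).injective) ?_)
  rw [snoc_eq_mul_chart a b c ht2, aeval_mul_of_isHomogeneous hY, ← h1, mul_zero]

open Polynomial in
theorem card_chart_zeros_le_of_root [Fintype k] [DecidableEq k] {a b c : k}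
    (hf : Irreducible (binaryForm a b c)) {α : K} (hαq : α ^ Fintype.card k ≠ α)
    (hαk : ∀ r, algebraMap k K r ≠ α)
    (hb : algebraMap k K b = - algebraMap k K a * (α + α ^ Fintype.card k))
    (hc : algebraMap k K c = algebraMap k K a * (α * α ^ Fintype.card k))
    {Y : MvPolynomial (Fin 4) k} {s : ℕ} (hY : Y.IsHomogeneous s)
    (hQY : ¬ normalForm a b c ∣ Y) (hs : s < Fintype.card k) :
    (Finset.univ.filter fun z : k × k =>
      MvPolynomial.eval (chart a b c z.1 z.2) Y = 0).card ≤ s * (Fintype.card k + 1) := by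
  classical
  set q := Fintype.card k with hq
  have hδ : α - α ^ q ≠ 0 := sub_ne_zero.2 (Ne.symm hαq)
  set p : K[X][X] := MvPolynomial.aeval (conjChart a b c α (α ^ q) (X : K[X][X]) (C X)) Y with hp
  have hp0 : p ≠ 0 := aeval_conjChart_ne_zero hf hδ hY hQY
  have hps : p.natDegree < q := by
    refine lt_of_le_of_lt ?_ hs
    rw [hp, ← MvPolynomial.aeval_map_algebraMap K[X]]
    refine (MvPolynomial.aeval_natDegree_le (m := s) (n := 1) _
      (hY.map _).totalDegree_le _ fun i => ?_).trans (by rw [mul_one])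
    refine natDegree_conjChart_le hδ hb hc Polynomial.natDegree_X_le
      (by rw [Polynomial.natDegree_C]; exact zero_le_one) ?_ i
    rw [mul_comm]
    exact (Polynomial.natDegree_C_mul_le _ _).trans Polynomial.natDegree_X_le
  -- The substitution v = u^q, with the outer variable as u and the inner one as v.
  let g : K[X][X] →ₐ[K] K[X] := Polynomial.eval₂AlgHom
    (Polynomial.expand K q) X (fun _ => Commute.all _ _)
  have hg0 : g p ≠ 0 := eval₂_expand_ne_zero hp0 hps
  have hgp : g p = MvPolynomial.aeval (conjChart a b c α (α ^ q) (X : K[X]) (X ^ q)) Y := by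
    rw [hp, map_aeval_conjChart]
    have hgX : g X = X := by simp [g]
    have hgC : g (C X) = X ^ q := by simp [g]
    rw [hgX, hgC]
  have hdeg : (g p).natDegree ≤ s * (q + 1) := by
    rw [hgp, ← MvPolynomial.aeval_map_algebraMap K]
    refine MvPolynomial.aeval_natDegree_le _ (hY.map _).totalDegree_le _ fun i => ?_
    refine natDegree_conjChart_le hδ hb hc (Polynomial.natDegree_X_le.trans (by omega))
      ((Polynomial.natDegree_X_pow_le _).trans (by omega)) ?_ i
    rw [← pow_succ']
    exact Polynomial.natDegree_X_pow_le _
  refine le_trans ?_ ((Multiset.toFinset_card_le _).trans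
    ((Polynomial.card_roots' (g p)).trans hdeg))
  -- A rational zero (x, y) gives the root u = x - αy, since Frobenius yields u^q = x - α^q y. As α
  -- is not in k, u determines (x, y).
  refine Finset.card_le_card_of_injOn
    (fun z => algebraMap k K z.1 - α * algebraMap k K z.2) ?_ ?_
  · intro z hz
    rw [Finset.mem_coe, Finset.mem_filter] at hz
    rw [Finset.mem_coe, Multiset.mem_toFinset, Polynomial.mem_roots hg0, Polynomial.IsRoot.def,
      ← Polynomial.coe_aeval_eq_eval, hgp, map_aeval_conjChart]
    simp only [map_pow, Polynomial.aeval_X]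
    have hfrob : (algebraMap k K z.1 - α * algebraMap k K z.2) ^ q
        = algebraMap k K z.1 - α ^ q * algebraMap k K z.2 := by
      have := map_sub (FiniteField.frobeniusAlgHom k K) (algebraMap k K z.1)
        (α * algebraMap k K z.2)
      rw [map_mul, AlgHom.commutes, AlgHom.commutes] at this
      exact this
    have hch := conjChart_eq_chart (A := K) (a := a) (b := b) (c := c) hδ
      (algebraMap k K z.1) (algebraMap k K z.2)
    simp only [Algebra.algebraMap_self, RingHom.id_apply] at hch
    rw [hfrob, hch]
    have hmap : chart a b c (algebraMap k K z.1) (algebraMap k K z.2)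
        = fun i => algebraMap k K (chart a b c z.1 z.2 i) := by
      funext i
      fin_cases i <;> simp [chart, binaryEval]
    rw [hmap]
    have := MvPolynomial.aeval_algebraMap_apply K (chart a b c z.1 z.2) Y
    rw [Function.comp_def] at this
    rw [this, MvPolynomial.aeval_eq_eval, hz.2, map_zero]
  · rintro ⟨x, y⟩ - ⟨x', y'⟩ - h
    simp only at h
    have hyy : y = y' := by
      by_contra hne
      apply hαk ((x - x') / (y - y'))
      have h0 : algebraMap k K y - algebraMap k K y' ≠ 0 := by
        rw [← map_sub, Ne, map_eq_zero]
        exact sub_ne_zero.2 hne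
      rw [map_div₀, map_sub, map_sub, div_eq_iff h0]
      linear_combination h
    subst hyy
    have hxx : x = x' := (algebraMap k K).injective (by linear_combination h)
    rw [hxx]

end Conjugate

/-- A form of degree `s < q` that does not vanish identically on the quadric in normal form has at
most `s (q + 1)` zeros in the affine part of the quadric. -/
theorem card_chart_zeros_le [Fintype k] [DecidableEq k] {a b c : k}
    (hf : Irreducible (binaryForm a b c)) {Y : MvPolynomial (Fin 4) k} {s : ℕ}
    (hY : Y.IsHomogeneous s) (hQY : ¬ normalForm a b c ∣ Y) (hs : s < Fintype.card k) :
    (Finset.univ.filter fun z : k × k =>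
      MvPolynomial.eval (chart a b c z.1 z.2) Y = 0).card ≤ s * (Fintype.card k + 1) := by
  obtain ⟨α, hαq, hαk, hb, hc⟩ := exists_conjugate_roots hf
  exact card_chart_zeros_le_of_root hf hαq hαk hb hc hY hQY hs

end Chart

/-! ### From vectors to projective points -/

section Points

variable {k : Type*} [Field k]

/-- A set of vectors containing the lines of all points of `S` has at least
`#S * (q - 1) + 1` elements. -/
theorem ncard_mul_add_one_le_card [Fintype k] {n : ℕ} (S : Set (ℙ k (Fin n → k)))
    (T : Finset (Fin n → k)) (hT : ∀ P ∈ S, ∀ a : k, a • P.rep ∈ T) (h0 : 0 ∈ T) :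
    S.ncard * (Fintype.card k - 1) + 1 ≤ T.card := by
  classical
  have hfin : Finite (ℙ k (Fin n → k)) := Quotient.finite _
  rw [Set.ncard_eq_toFinset_card S (Set.toFinite S)]
  have hq : (Finset.univ.filter fun r : k => r ≠ 0).card = Fintype.card k - 1 := by
    rw [Finset.filter_ne', Finset.card_erase_of_mem (Finset.mem_univ _), Finset.card_univ]
  rw [← Finset.card_erase_add_one h0, ← hq, ← Finset.card_product]
  refine Nat.add_le_add_right (Finset.card_le_card_of_injOn (fun z => z.2 • z.1.rep) ?_ ?_) 1
  · rintro ⟨P, a⟩ h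
    simp only [Finset.coe_product, Set.mem_prod, Finset.mem_coe, Set.Finite.mem_toFinset,
      Finset.mem_filter, Finset.mem_univ, true_and] at h
    rw [Finset.mem_coe, Finset.mem_erase]
    exact ⟨smul_ne_zero h.2 P.rep_nonzero, hT P h.1 a⟩
  · rintro ⟨P, a⟩ h ⟨P', a'⟩ h' heq
    simp only [Finset.coe_product, Set.mem_prod, Finset.mem_coe, Set.Finite.mem_toFinset,
      Finset.mem_filter, Finset.mem_univ, true_and] at h h' heq
    have hPP : P = P' := by
      rw [← P.mk_rep, ← P'.mk_rep, Projectivization.mk_eq_mk_iff']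
      refine ⟨a⁻¹ * a', ?_⟩
      rw [mul_smul, ← heq, smul_smul, inv_mul_cancel₀ h.2, one_smul]
    subst hPP
    rw [smul_left_injective k P.rep_nonzero heq]

theorem card_zeros_linearSubst [Fintype k] [DecidableEq k] (g : GL (Fin 4) k)
    (Q Y : MvPolynomial (Fin 4) k) :
    (Finset.univ.filter fun v : Fin 4 → k =>
      MvPolynomial.eval v Q = 0 ∧ MvPolynomial.eval v Y = 0).card
    = (Finset.univ.filter fun v : Fin 4 → k =>
      MvPolynomial.eval v (linearSubst g Q) = 0 ∧
        MvPolynomial.eval v (linearSubst g Y) = 0).card := by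
  symm
  simp only [eval_linearSubst]
  have h1 : (g : Matrix (Fin 4) (Fin 4) k) * ((g⁻¹ : GL (Fin 4) k) : Matrix (Fin 4) (Fin 4) k)
      = 1 := Units.mul_inv g
  have h2 : ((g⁻¹ : GL (Fin 4) k) : Matrix (Fin 4) (Fin 4) k) * (g : Matrix (Fin 4) (Fin 4) k)
      = 1 := Units.inv_mul g
  refine Finset.card_bij (fun v _ => (g : Matrix (Fin 4) (Fin 4) k).mulVec v) ?_ ?_ ?_
  · intro v hv
    simpa using hv
  · intro v _ w _ h
    have := congrArg ((g⁻¹ : GL (Fin 4) k) : Matrix (Fin 4) (Fin 4) k).mulVec h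
    simpa [Matrix.mulVec_mulVec, h2] using this
  · intro w hw
    refine ⟨((g⁻¹ : GL (Fin 4) k) : Matrix (Fin 4) (Fin 4) k).mulVec w, ?_, ?_⟩
    · simpa [Matrix.mulVec_mulVec, h1] using hw
    · rw [Matrix.mulVec_mulVec, h1, Matrix.one_mulVec]

/-- The chart count with Y = 0, for which all q² points of the chart are zeros. -/
theorem IsEllipticQuadric.card_zeros_le [Fintype k] [DecidableEq k] {Q : MvPolynomial (Fin 4) k}
    (hQ : IsEllipticQuadric Q) :
    (Finset.univ.filter fun v : Fin 4 → k => MvPolynomial.eval v Q = 0).card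
      ≤ (Fintype.card k - 1) * Fintype.card k ^ 2 + Fintype.card k := by
  obtain ⟨g, a, b, c, hf, hg⟩ := hQ
  have h1 := card_zeros_linearSubst g Q 0
  rw [linearSubst_apply, hg] at h1
  have h2 := card_zeros_le_card_chart hf (MvPolynomial.isHomogeneous_zero (Fin 4) k 0)
  simp only [map_zero, and_true, Finset.filter_true, Finset.card_univ, Fintype.card_prod] at h1 h2
  rw [h1, pow_two]
  exact h2

theorem IsEllipticQuadric.card_common_zeros_le [Fintype k] [DecidableEq k]
    {Q Y : MvPolynomial (Fin 4) k} (hQ : IsEllipticQuadric Q) {s : ℕ} (hY : Y.IsHomogeneous s)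
    (hQY : ¬ Q ∣ Y) (hs : s < Fintype.card k) :
    (Finset.univ.filter fun v : Fin 4 → k =>
      MvPolynomial.eval v Q = 0 ∧ MvPolynomial.eval v Y = 0).card
    ≤ (Fintype.card k - 1) * (s * (Fintype.card k + 1)) + Fintype.card k := by
  obtain ⟨g, a, b, c, hf, hg⟩ := hQ
  rw [← linearSubst_apply] at hg
  have hgY := isHomogeneous_linearSubst g hY
  have hQY' : ¬ normalForm a b c ∣ linearSubst g Y := by
    rw [normalForm, ← hg]
    exact fun h => hQY ((map_dvd_iff (linearSubst g)).1 h)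
  rw [card_zeros_linearSubst g Q Y, hg]
  refine (card_zeros_le_card_chart hf hgY).trans ?_
  gcongr
  exact card_chart_zeros_le hf hgY hQY' hs

theorem smul_rep_mem_zeros {Q : MvPolynomial (Fin 4) k} {E : PrimeDivisor Q}
    {P : ℙ k (Fin 4 → k)} (hP : P ∈ E.rationalPoints) {F : MvPolynomial (Fin 4) k} {n : ℕ}
    (hF : F.IsHomogeneous n) (hFE : F ∈ E.ideal) (a : k) : MvPolynomial.eval (a • P.rep) F = 0 := by
  have h := aeval_mul_of_isHomogeneous hF P.rep a
  have h1 : MvPolynomial.aeval P.rep F = 0 := hP F hFE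
  rw [h1, mul_zero] at h
  exact h

end Points

end QuadricSurface

end

/-! ### Conclusion: comparison of the bounds -/

theorem mainTheorem3 {k : Type*} [Field k] [Fintype k]
    (Q : MvPolynomial (Fin 4) k) (hQ : QuadricSurface.IsEllipticQuadric Q)
    (h : MvPolynomial (Fin 4) k) (hh : h.IsHomogeneous 1) (hQh : ¬ Q ∣ h)
    (s : ℕ) (hs : 2 ≤ s) (D : QuadricSurface.PrimeDivisor Q)
    (hD : QuadricSurface.LinearlyEquivalent hQ.prime
      (Finsupp.single D 1) (s • QuadricSurface.formDivisor hQ.prime hQh)) :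
    D.rationalPoints.ncard ≤ Fintype.card k * (2 * s - 2) := by
  classical
  have hdom := hQ.isDomain
  have hufd := hQ.uniqueFactorizationMonoid
  have hQd := hQ.isHomogeneous
  obtain ⟨Y, hY, hQY, hideal⟩ := QuadricSurface.exists_ideal_eq_span_of_linearlyEquivalent hQd
    hQ.prime hh hQh s D hD
  have hYD : Y ∈ D.ideal := by
    rw [hideal]
    exact Ideal.subset_span (by simp)
  have h1 := QuadricSurface.ncard_mul_add_one_le_card D.rationalPoints
    (Finset.univ.filter fun v : Fin 4 → k =>
      MvPolynomial.eval v Q = 0 ∧ MvPolynomial.eval v Y = 0)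
    (fun P hP a => by
      rw [Finset.mem_filter]
      exact ⟨Finset.mem_univ _, QuadricSurface.smul_rep_mem_zeros hP hQd D.mem a,
        QuadricSurface.smul_rep_mem_zeros hP hY hYD a⟩)
    (by
      rw [Finset.mem_filter]
      refine ⟨Finset.mem_univ _, ?_, ?_⟩
      · rw [MvPolynomial.eval_zero, MvPolynomial.constantCoeff_eq]
        exact hQd.coeff_eq_zero (by simp)
      · rw [MvPolynomial.eval_zero, MvPolynomial.constantCoeff_eq]
        exact hY.coeff_eq_zero (by simp; omega))
  have hZ := hQ.card_zeros_le
  have hle : (Finset.univ.filter fun v : Fin 4 → k =>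
      MvPolynomial.eval v Q = 0 ∧ MvPolynomial.eval v Y = 0).card
      ≤ (Finset.univ.filter fun v : Fin 4 → k => MvPolynomial.eval v Q = 0).card :=
    Finset.card_le_card (Finset.monotone_filter_right _ fun v _ hv => hv.1)
  have hq : 1 < Fintype.card k := Fintype.one_lt_card
  obtain ⟨r, hr⟩ : ∃ r, Fintype.card k = r + 2 := ⟨Fintype.card k - 2, by omega⟩
  have hr1 : Fintype.card k - 1 = r + 1 := by omega
  rw [hr1] at h1 hZ
  have hpos : 0 < r + 1 := Nat.succ_pos r
  rcases hs.eq_or_lt with rfl | hs3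
  · have h2 := QuadricSurface.card_mul_card_common_zeros_add_le hQd hY (hideal ▸ D.isPrime) hQY
    rw [hr] at h2 hZ ⊢
    set n := (Finset.univ.filter fun v : Fin 4 → k =>
      MvPolynomial.eval v Q = 0 ∧ MvPolynomial.eval v Y = 0).card
    -- With q = r + 2 this says that there are at most 2q(q - 1) + 1 common zeros, hence at most 2q
    -- points.
    have h3 : (r + 2) * n ≤ (r + 2) * (2 * (r + 2) * (r + 1) + 1) := by nlinarith
    have h4 := Nat.le_of_mul_le_mul_left h3 (by omega)
    refine Nat.le_of_mul_le_mul_right (c := r + 1) ?_ hpos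
    nlinarith
  · obtain ⟨t, rfl⟩ : ∃ t, s = t + 3 := ⟨s - 3, by omega⟩
    have ht : 2 * (t + 3) - 2 = 2 * t + 4 := by omega
    rw [ht]
    -- If q + 1 ≤ 2s - 2, all points of X may be allowed: q² + 1 ≤ q(q + 1) ≤ q(2s - 2).
    by_cases hqs : Fintype.card k + 1 ≤ 2 * t + 4
    · have h2 := h1.trans (hle.trans hZ)
      rw [hr] at h2 hqs ⊢
      refine (Nat.le_of_mul_le_mul_right (c := r + 1) (b := (r + 2) * (r + 3)) ?_ hpos).trans
        (Nat.mul_le_mul_left _ (by omega))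
      nlinarith
    -- Here q ≥ 2s - 2 > s because s ≥ 3.
    · have h2 := hQ.card_common_zeros_le hY hQY (by omega)
      rw [hr1] at h2
      have h3 := h1.trans h2
      rw [hr] at h3 hqs ⊢
      have h4 : D.rationalPoints.ncard ≤ (t + 3) * (r + 3) + 1 :=
        Nat.le_of_mul_le_mul_right (c := r + 1) (by nlinarith) hpos
      refine h4.trans ?_
      -- The inequality s(q + 1) + 1 ≤ q(2s - 2) means s + 1 ≤ q(s - 2); it is sharp at s = 3, q =
      -- 4.
      obtain ⟨u, rfl⟩ : ∃ u, r = 2 * t + 2 + u := ⟨r - (2 * t + 2), by omega⟩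
      nlinarith [Nat.zero_le (t * u), Nat.zero_le (t * t)]
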